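/- **Proposition 2.5.** Let $F$ be a field and let $\Gamma=(V,E)$ be a layered graph: a directed graph (multiple edges allowed) with tail and head maps $t,h:E\to V$, whose vertex set is a disjoint union $V=V_0\sqcup V_1\sqcup\dots\sqcup V_n$ and such that every edge goes from some $V_i$ to $V_{i-1}$, $1\le i\le n$. Write $|v|=i$ for $v\in V_i$, $|e|=|t(e)|$ for $e\in E$, and $V^+=V_1\cup\dots\cup V_n$. Assume that $V_0=\{*\}$ is a single vertex and that every $v\in V^+$ is the tail of at least one edge. For a path $\pi=(e_1,\dots,e_m)$, of length $l(\pi)=m$ and with vertices $v_0=t(e_1)$, $v_i=h(e_i)=t(e_{i+1})$, $v_m=h(e_m)$, define $e(\pi,k)\in T(E)$ by $(1-te_1)(1-te_2)\cdots(1-te_m)=\sum_k e(\pi,k)t^k$ in $T(E)[t]$, where $T(E)$ is the tensor algebra over $F$ of the vector space with basis $E$. Let $A(\Gamma)=T(E)/R$, where $R$ is the two-sided ideal generated by all $e(\pi_1,k)-e(\pi_2,k)$ with $\pi_1,\pi_2$ paths having the same tail and the same head and $1\le k\le l(\pi_1)$. Filter $A(\Gamma)$ by the images $A(\Gamma)_i$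 of $\mathrm{span}\{e_1\cdots e_r : r\ge 0,\ |e_1|+\dots+|e_r|\le i\}$, and let $\mathrm{gr}\,A(\Gamma)=\bigoplus_{i\ge0}A(\Gamma)_i/A(\Gamma)_{i-1}$ (with $A(\Gamma)_{-1}=0$) be the associated graded algebra. For a path $\pi$ as above put $v(\pi,k)=v_0v_1\cdots v_{k-1}$ $(1\le k\le m+1)$. Let $T(V^+)$ be the tensor algebra over $F$ of the vector space with basis $V^+$, graded by giving $v\in V^+$ degree $|v|$, and let $R_{gr}$ be the two-sided ideal of $T(V^+)$ generated by all $v(\pi_1,k)-v(\pi_2,k)$ where $\pi_1,\pi_2$ are paths with the same tail, $2\le k\le l(\pi_1)$ and $k\le l(\pi_2)+1$ (so that $v(\pi_2,k)$ is defined). Then there is an isomorphism of graded $F$-algebras $$\mathrm{gr}\,A(\Gamma)\;\cong\;T(V^+)/R_{gr}$$ which, for every edge $e\in E$, sends the class of $e$ in $A(\Gamma)_{|e|}/A(\Gamma)_{|e|-1}$ to the class of the vertex $t(e)$. -/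

import Mathlib

noncomputable section

/-! ### Filtered algebras and their associated graded algebras -/

/-- An increasing algebra filtration `A_0 ⊆ A_1 ⊆ A_2 ⊆ ⋯` of an `F`-algebra `A`
(with `A_{-1} = 0` understood). -/
structure AlgFiltration (F : Type*) (A : Type*) [Field F] [Ring A] [Algebra F A] where
  piece : ℕ → Submodule F A
  mono : Monotone piece
  one_mem : (1 : A) ∈ piece 0
  mul_mem : ∀ {i j : ℕ} {x y : A}, x ∈ piece i → y ∈ piece j → x * y ∈ piece (i + j)

namespace AlgFiltration

section gr

variable {F : Type*} {A : Type*} [Field F] [Ring A] [Algebra F A] (fil : AlgFiltration F A)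

/-- The preceding step `A_{i-1}` of the filtration, with `A_{-1} = 0`. -/
def lower : ℕ → Submodule F A
  | 0 => ⊥
  | i + 1 => fil.piece i

theorem mul_lower {i j : ℕ} {x y : A} (hx : x ∈ fil.piece i) (hy : y ∈ fil.lower j) :
    x * y ∈ fil.lower (i + j) := by
  cases j with
  | zero =>
    have h0 : y = 0 := hy
    rw [h0, mul_zero]
    exact Submodule.zero_mem _
  | succ j => exact fil.mul_mem hx hy

theorem lower_mul {i j : ℕ} {x y : A} (hx : x ∈ fil.lower i) (hy : y ∈ fil.piece j) :
    x * y ∈ fil.lower (i + j) := by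
  cases i with
  | zero =>
    have h0 : x = 0 := hx
    rw [h0, zero_mul]
    exact Submodule.zero_mem _
  | succ i =>
    rw [Nat.succ_add]
    exact fil.mul_mem hx hy

/-- `A_{i-1}` as a subspace of `A_i`. -/
def lowerIn (i : ℕ) : Submodule F (fil.piece i) := (fil.lower i).comap (fil.piece i).subtype

/-- The `i`-th component `A_i / A_{i-1}` of the associated graded algebra. -/
def Gr (i : ℕ) : Type _ := fil.piece i ⧸ fil.lowerIn i

instance (i : ℕ) : AddCommGroup (fil.Gr i) := inferInstanceAs (AddCommGroup (_ ⧸ fil.lowerIn i))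

instance (i : ℕ) : Module F (fil.Gr i) := inferInstanceAs (Module F (_ ⧸ fil.lowerIn i))

/-- The class in `A_i / A_{i-1}` of an element of `A_i`. -/
def toGr (i : ℕ) : fil.piece i →ₗ[F] fil.Gr i := (fil.lowerIn i).mkQ

theorem toGr_surjective (i : ℕ) : Function.Surjective (fil.toGr i) :=
  Submodule.mkQ_surjective _

theorem toGr_eq_zero {i : ℕ} {x : fil.piece i} (hx : (x : A) ∈ fil.lower i) :
    fil.toGr i x = 0 :=
  (Submodule.Quotient.mk_eq_zero (fil.lowerIn i)).2 hx

/-- The product of representatives, `A_i × A_j → A_{i+j} / A_{i+j-1}`. -/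
def preMul (i j : ℕ) : fil.piece i →ₗ[F] fil.piece j →ₗ[F] fil.Gr (i + j) :=
  LinearMap.mk₂ F (fun x y => fil.toGr (i + j) ⟨(x : A) * y, fil.mul_mem x.2 y.2⟩)
    (fun x x' y => by
      rw [← map_add]; congr 1; exact Subtype.ext (add_mul (x : A) x' y))
    (fun c x y => by
      rw [← map_smul]; congr 1; exact Subtype.ext (smul_mul_assoc c (x : A) (y : A)))
    (fun x y y' => by
      rw [← map_add]; congr 1; exact Subtype.ext (mul_add (x : A) y y'))
    (fun c x y => by
      rw [← map_smul]; congr 1; exact Subtype.ext (mul_smul_comm c (x : A) (y : A)))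

/-- The multiplication `A_i / A_{i-1} × A_j / A_{j-1} → A_{i+j} / A_{i+j-1}` induced by that
of `A`. -/
def grMul (i j : ℕ) : fil.Gr i →ₗ[F] fil.Gr j →ₗ[F] fil.Gr (i + j) :=
  LinearMap.liftQ₂ (fil.lowerIn i) (fil.lowerIn j) (fil.preMul i j)
    (fun _ hx => LinearMap.ext fun y => fil.toGr_eq_zero (fil.lower_mul hx y.2))
    (fun _ hy => LinearMap.ext fun x => fil.toGr_eq_zero (fil.mul_lower x.2 hy))

theorem grMul_toGr {i j : ℕ} (x : fil.piece i) (y : fil.piece j) :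
    fil.grMul i j (fil.toGr i x) (fil.toGr j y)
      = fil.toGr (i + j) ⟨(x : A) * y, fil.mul_mem x.2 y.2⟩ := rfl

theorem mk_toGr_congr {i j : ℕ} (hij : i = j) {x : fil.piece i} {y : fil.piece j}
    (h : (x : A) = y) :
    GradedMonoid.mk (A := fil.Gr) i (fil.toGr i x) = GradedMonoid.mk j (fil.toGr j y) := by
  subst hij
  rw [Subtype.ext h]

instance : GradedMonoid.GOne fil.Gr where
  one := fil.toGr 0 ⟨1, fil.one_mem⟩

instance : GradedMonoid.GMul fil.Gr where
  mul {i j} x y := fil.grMul i j x y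

theorem mk_mul_mk_toGr {i j : ℕ} (x : fil.piece i) (y : fil.piece j) :
    GradedMonoid.mk (A := fil.Gr) i (fil.toGr i x) * GradedMonoid.mk j (fil.toGr j y)
      = GradedMonoid.mk (i + j) (fil.toGr (i + j) ⟨(x : A) * y, fil.mul_mem x.2 y.2⟩) := rfl

/-- The associated graded object is a graded ring. -/
instance : DirectSum.GSemiring fil.Gr where
  mul_zero {i j} x := (fil.grMul i j x).map_zero
  zero_mul {i j} y := (fil.grMul i j).map_zero₂ y
  mul_add {i j} x y y' := (fil.grMul i j x).map_add y y'
  add_mul {i j} x x' y := (fil.grMul i j).map_add₂ x x' y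
  one_mul := by
    rintro ⟨i, x⟩
    obtain ⟨x, rfl⟩ := fil.toGr_surjective i x
    exact fil.mk_toGr_congr (x := ⟨1 * (x : A), fil.mul_mem fil.one_mem x.2⟩) (y := x)
      (zero_add i) (one_mul (x : A))
  mul_one := by
    rintro ⟨i, x⟩
    obtain ⟨x, rfl⟩ := fil.toGr_surjective i x
    exact fil.mk_toGr_congr (x := ⟨(x : A) * 1, fil.mul_mem x.2 fil.one_mem⟩) (y := x)
      (add_zero i) (mul_one (x : A))
  mul_assoc := by
    rintro ⟨i, x⟩ ⟨j, y⟩ ⟨k, z⟩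
    obtain ⟨x, rfl⟩ := fil.toGr_surjective i x
    obtain ⟨y, rfl⟩ := fil.toGr_surjective j y
    obtain ⟨z, rfl⟩ := fil.toGr_surjective k z
    exact fil.mk_toGr_congr
      (x := ⟨(x : A) * y * z, fil.mul_mem (fil.mul_mem x.2 y.2) z.2⟩)
      (y := ⟨(x : A) * (y * z), fil.mul_mem x.2 (fil.mul_mem y.2 z.2)⟩)
      (add_assoc i j k) (mul_assoc (x : A) y z)
  natCast n := n • fil.toGr 0 ⟨1, fil.one_mem⟩
  natCast_zero := zero_nsmul _
  natCast_succ n := succ_nsmul _ n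

/-- The associated graded ring is a graded `F`-algebra. -/
instance : DirectSum.GAlgebra F fil.Gr where
  toFun := ((fil.toGr 0).comp
    (LinearMap.toSpanSingleton F (fil.piece 0) ⟨1, fil.one_mem⟩)).toAddMonoidHom
  map_one := congrArg (fil.toGr 0) (one_smul F (⟨1, fil.one_mem⟩ : fil.piece 0))
  map_mul r s := fil.mk_toGr_congr (x := (r * s) • ⟨1, fil.one_mem⟩)
    (y := ⟨(r • (1 : A)) * (s • (1 : A)), fil.mul_mem ((fil.piece 0).smul_mem r fil.one_mem)
      ((fil.piece 0).smul_mem s fil.one_mem)⟩) (zero_add 0).symm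
    (by simp [mul_smul, smul_comm r s])
  commutes := by
    rintro r ⟨i, x⟩
    obtain ⟨x, rfl⟩ := fil.toGr_surjective i x
    exact fil.mk_toGr_congr
      (x := ⟨(r • (1 : A)) * (x : A), fil.mul_mem ((fil.piece 0).smul_mem r fil.one_mem) x.2⟩)
      (y := ⟨(x : A) * (r • (1 : A)), fil.mul_mem x.2 ((fil.piece 0).smul_mem r fil.one_mem)⟩)
      ((zero_add i).trans (add_zero i).symm) (by simp)
  smul_def := by
    rintro r ⟨i, x⟩
    obtain ⟨x, rfl⟩ := fil.toGr_surjective i x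
    exact fil.mk_toGr_congr (x := r • x)
      (y := ⟨(r • (1 : A)) * (x : A), fil.mul_mem ((fil.piece 0).smul_mem r fil.one_mem) x.2⟩)
      (zero_add i).symm (by simp)

/-- The associated graded algebra `gr A = ⨁ i, A_i / A_{i-1}`. -/
abbrev GrAlgebra : Type _ := DirectSum ℕ fil.Gr

/-- The image of the component `A_i / A_{i-1}` in `gr A`. -/
def grComponent (i : ℕ) : Submodule F fil.GrAlgebra :=
  LinearMap.range (DirectSum.lof F ℕ fil.Gr i)

/-- The class `x + A_{i-1} ∈ A_i / A_{i-1} ⊆ gr A` of an element `x ∈ A_i`. -/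
def grClass {i : ℕ} (x : A) (hx : x ∈ fil.piece i) : fil.GrAlgebra :=
  DirectSum.lof F ℕ fil.Gr i (fil.toGr i ⟨x, hx⟩)

/-- The filtration of `B` by the images of the `A_i` under an algebra map `A → B`. -/
def map {B : Type*} [Ring B] [Algebra F B] (f : A →ₐ[F] B) : AlgFiltration F B where
  piece i := (fil.piece i).map f.toLinearMap
  mono _ _ hij := Submodule.map_mono (fil.mono hij)
  one_mem := ⟨1, fil.one_mem, map_one f⟩
  mul_mem := by
    rintro i j _ _ ⟨x, hx, rfl⟩ ⟨y, hy, rfl⟩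
    exact ⟨x * y, fil.mul_mem hx hy, map_mul f x y⟩

end gr

end AlgFiltration

/-! ### The tensor algebra on a weighted set -/

/-- The tensor algebra `T(X)` over `F` of the vector space `FX` with basis `X`. -/
abbrev TensorOn (F : Type*) [Field F] (X : Type*) : Type _ := TensorAlgebra F (X →₀ F)

namespace TensorOn

section weight

variable (F : Type*) [Field F] {X : Type*}

/-- The basis vector `x ∈ X`, as an element of `T(X)`. -/
def gen (x : X) : TensorOn F X := TensorAlgebra.ι F (Finsupp.single x 1)

/-- The monomial `x_1 x_2 ⋯ x_r ∈ T(X)`. -/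
def word (l : List X) : TensorOn F X := (l.map (gen F)).prod

/-- When `x ∈ X` has degree `d x`, the homogeneous component
`T(X)_{[i]} = span {x_1 ⋯ x_r | d x_1 + ⋯ + d x_r = i}`. -/
def component (d : X → ℕ) (i : ℕ) : Submodule F (TensorOn F X) :=
  Submodule.span F {a | ∃ l : List X, (l.map d).sum = i ∧ a = word F l}

/-- When `x ∈ X` has degree `d x`, the filtration with steps
`T(X)_i = span {x_1 ⋯ x_r | d x_1 + ⋯ + d x_r ≤ i}`. -/
def filtration (d : X → ℕ) : AlgFiltration F (TensorOn F X) where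
  piece i := Submodule.span F {a | ∃ l : List X, (l.map d).sum ≤ i ∧ a = word F l}
  mono i j hij := Submodule.span_mono fun _ ⟨l, hl, ha⟩ => ⟨l, hl.trans hij, ha⟩
  one_mem := Submodule.subset_span ⟨[], by simp, by simp [word]⟩
  mul_mem := by
    intro i j x y hx hy
    have hxy := Submodule.mul_mem_mul hx hy
    rw [Submodule.span_mul_span] at hxy
    refine Submodule.span_mono ?_ hxy
    rintro _ ⟨_, ⟨l, hl, rfl⟩, _, ⟨m, hm, rfl⟩, rfl⟩
    exact ⟨l ++ m, by simpa using add_le_add hl hm, by simp [word]⟩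

theorem gen_mem_filtration (d : X → ℕ) (x : X) : gen F x ∈ (filtration F d).piece (d x) :=
  Submodule.subset_span ⟨[x], by simp, by simp [word]⟩

end weight

end TensorOn

/-! ### Layered graphs -/

/-- A layered graph with vertex set `V = V_0 ⊔ ⋯ ⊔ V_n` and edge set `E = E_1 ⊔ ⋯ ⊔ E_n`, where
edges in `E_i` go from `V_i` to `V_{i-1}`. Here `V_i` is the set of vertices with `level v = i`,
and `E_i` the set of edges `e` with `level (tail e) = i`. Multiple edges are allowed. -/
structure LayeredGraph (V : Type*) (E : Type*) where
  tail : E → V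
  head : E → V
  n : ℕ
  level : V → ℕ
  level_le : ∀ v, level v ≤ n
  level_tail : ∀ e, level (tail e) = level (head e) + 1

namespace LayeredGraph

section graph

variable {V : Type*} {E : Type*} (G : LayeredGraph V E) (F : Type*) [Field F]

/-- The set `V^+ = V_1 ∪ ⋯ ∪ V_n`. -/
abbrev VPlus : Type _ := {v : V // 0 < G.level v}

/-- The degree of an edge: `|e| = i` for `e ∈ E_i`. -/
def edgeDegree (e : E) : ℕ := G.level (G.tail e)

/-- The degree of a vertex of `V^+`: `|v| = i` for `v ∈ V_i`. -/
def vertexDegree (v : G.VPlus) : ℕ := G.level v.1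

/-- The list of edges `e_1, …, e_m` is a path from `v` to `w` (the empty list is the trivial
path from `v` to `v`). -/
def IsPath : V → List E → V → Prop
  | v, [], w => v = w
  | v, e :: es, w => G.tail e = v ∧ IsPath (G.head e) es w

/-- `e(π, k)`, the coefficient of `t ^ k` in `(1 - t e_1) ⋯ (1 - t e_m) ∈ T(E)[t]`, for the path
`π = e_1, …, e_m`. -/
def pathCoeff (es : List E) (k : ℕ) : TensorOn F E :=
  (es.map fun e => (1 - Polynomial.X * Polynomial.C (TensorOn.gen F e) :
    Polynomial (TensorOn F E))).prod.coeff k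

/-- The generators `e(π₁, k) - e(π₂, k)` of `R`, where the paths `π₁, π₂` have the same tail and
the same head, and `1 ≤ k ≤ l(π₁)`. -/
def relators : Set (TensorOn F E) :=
  {x | ∃ (v w : V) (p₁ p₂ : List E) (k : ℕ), G.IsPath v p₁ w ∧ G.IsPath v p₂ w ∧
    1 ≤ k ∧ k ≤ p₁.length ∧ x = pathCoeff F p₁ k - pathCoeff F p₂ k}

/-- The two-sided ideal `R` of `T(E)`. -/
def idealR : TwoSidedIdeal (TensorOn F E) := TwoSidedIdeal.span (G.relators F)

/-- The algebra `A(Γ) = T(E) / R`. -/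
abbrev Alg : Type _ := (G.idealR F).ringCon.Quotient

/-- The canonical map `T(E) → A(Γ)`. -/
def toAlg : TensorOn F E →ₐ[F] G.Alg F := (G.idealR F).ringCon.mkₐ (α := F)

/-- The filtration of `A(Γ)` by the images `A(Γ)_i` of
`T(E)_i = span {e_1 ⋯ e_r | |e_1| + ⋯ + |e_r| ≤ i}`. -/
def algFiltration : AlgFiltration F (G.Alg F) :=
  (TensorOn.filtration F G.edgeDegree).map (G.toAlg F)

/-- The associated graded algebra `gr A(Γ)`. -/
abbrev GrAlg : Type _ := (G.algFiltration F).GrAlgebra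

theorem edge_mem (e : E) :
    G.toAlg F (TensorOn.gen F e) ∈ (G.algFiltration F).piece (G.edgeDegree e) :=
  ⟨_, TensorOn.gen_mem_filtration F G.edgeDegree e, rfl⟩

/-- The class of the edge `e` in `A(Γ)_i / A(Γ)_{i-1} ⊆ gr A(Γ)`, where `i = |e|`. -/
def edgeClass (e : E) : G.GrAlg F :=
  (G.algFiltration F).grClass (i := G.edgeDegree e) (G.toAlg F (TensorOn.gen F e)) (G.edge_mem F e)

open Classical in
/-- A vertex of `V^+` as an element of `T(V^+)`; vertices of level `0` are sent to `0`. -/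
def vertexGen (v : V) : TensorOn F G.VPlus :=
  if h : 0 < G.level v then TensorOn.gen F (⟨v, h⟩ : G.VPlus) else 0

/-- `v(π, k) = v_0 v_1 ⋯ v_{k-1} ∈ T(V^+)` for a path `π = e_1, …, e_m` from `v` that passes through
the vertices `v_0 = v, v_1, …, v_m`. It is used for `k ≤ m + 1` and only when the vertices
`v_0, …, v_{k-1}` lie in `V^+`. -/
def vertexWord (v : V) (es : List E) (k : ℕ) : TensorOn F G.VPlus :=
  (((v :: es.map G.head).take k).map (G.vertexGen F)).prod

/-- The generators `v(π₁, k) - v(π₂, k)` of `R_gr`, where the paths `π₁, π₂` have the same tail,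
`2 ≤ k ≤ l(π₁)`, and `k ≤ l(π₂) + 1`, so that `v(π₂, k)` is defined. -/
def grRelators : Set (TensorOn F G.VPlus) :=
  {x | ∃ (v w₁ w₂ : V) (p₁ p₂ : List E) (k : ℕ), G.IsPath v p₁ w₁ ∧ G.IsPath v p₂ w₂ ∧
    2 ≤ k ∧ k ≤ p₁.length ∧ k ≤ p₂.length + 1 ∧
    x = G.vertexWord F v p₁ k - G.vertexWord F v p₂ k}

/-- The two-sided ideal `R_gr` of `T(V^+)`. -/
def idealRgr : TwoSidedIdeal (TensorOn F G.VPlus) := TwoSidedIdeal.span (G.grRelators F)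

/-- The algebra `T(V^+) / R_gr`. -/
abbrev GrQuotient : Type _ := (G.idealRgr F).ringCon.Quotient

/-- The canonical map `T(V^+) → T(V^+) / R_gr`. -/
def toGrQuotient : TensorOn F G.VPlus →ₐ[F] G.GrQuotient F :=
  (G.idealRgr F).ringCon.mkₐ (α := F)

/-- The image in `T(V^+) / R_gr` of
`T(V^+)_{[i]} = span {v_1 ⋯ v_r | |v_1| + ⋯ + |v_r| = i}`. -/
def grQuotientComponent (i : ℕ) : Submodule F (G.GrQuotient F) :=
  (TensorOn.component F G.vertexDegree i).map (G.toGrQuotient F).toLinearMap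

end graph

end LayeredGraph

end

/-! # The associated graded algebra of the algebra of a layered graph

Write `B = T(V⁺) / R_gr`. A homomorphism `Θ : B → gr A(Γ)` sends a vertex `v` to the class of an
edge with tail `v`. It is well defined because the coefficients `e(π, k)` do not depend on the path
`π` from `v` to the minimal vertex, while the leading term of `e(π, k)` is, up to sign, the product
of the first `k` edges of `π` (`coeffClass_cons`, `lift_edgeClass_vertexWord`). It is graded and
surjective since the classes of edges generate `gr A(Γ)` (`map_grQuotientComponent`).

Injectivity is the point of the proof. It suffices that `A(Γ)` acts on the vector space `B` in such
a way that each edge `e` acts as the multiplication by the vertex `t(e)` up to terms of lower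
degree (`SymbolAlgebra.exists_action`): a homogeneous `y ∈ T(V⁺)` of degree `i` whose lift to `A(Γ)`
falls into `A(Γ)_{i-1}` then satisfies `y = y · 1 = 0` in `B`, up to terms of degree less than `i`
(`toGrAlg_injective`).

An action of `A(Γ)` on `B` amounts to monic polynomials `P_v` of degree `|v|` over `End B` with
`P_v = (X + r_e) P_w` for each edge `e` from `v` to `w`; the edge `e` acts as `r_e`. Such a `P_v`
is the characteristic polynomial of a linear recurrence of order `|v|` on sequences in `B`, with
solution space `K_v`, and the divisibility says that `K_w ⊆ K_v`
(`SymbolAlgebra.exists_eq_X_add_C_mul`). So `P_v` is to be constructed, by induction on `|v|`, as a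
recurrence with prescribed leading terms `β v i` that is satisfied by all `K_w`, where `w` runs over
the heads of the edges that start at `v`. This is a problem of extending a filtered linear map from
`∑ K_w` to all sequences (`exists_filtered_extension`), and it is solvable because the filtration
on `∑ K_w` is the sum of the filtrations on the `K_w` (`SymbolAlgebra.iSup_solutions_inf_le`).

The last fact is proved by descending along the leading terms. A cancellation of leading terms
among solutions at vertices `w` gives a relation `∑ w y_w = 0` in `B`, and in `B` every relation of
this form is a consequence of the defining ones: `y_w` lies in the right ideal generated by the
differences of the classes of paths that start at heads of edges from `w`
(`mem_syzygyIdeal_of_sum_eq_zero`). Sums of solutions at those heads realize the generators of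
this right ideal, so that the cancelling parts can be moved one level down.
-/

open Polynomial

/-! ### Extension of filtered linear maps -/

/-- Over a field, a linear map `g` that respects filtrations on
a subspace `L` agrees on `L` with a linear map that respects them everywhere. -/
theorem exists_filtered_extension {F X Y : Type*} [Field F] [AddCommGroup X] [Module F X]
    [AddCommGroup Y] [Module F Y] (T : ℤ → Submodule F X) (N : ℤ → Submodule F Y)
    (hT : Monotone T) (hex : ∀ x, ∃ d, x ∈ T d) (d₀ : ℤ) (L : Submodule F X) (g : X →ₗ[F] Y)
    (hg : ∀ d, d₀ ≤ d → ∀ x ∈ L, x ∈ T d → g x ∈ N d) :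
    ∃ h : X →ₗ[F] Y, (∀ x ∈ L, h x = g x) ∧ ∀ d, d₀ ≤ d → ∀ x ∈ T d, h x ∈ N d := by
  obtain ⟨f, hLf, hf⟩ := zorn_le_nonempty₀
    {f : X →ₗ.[F] Y | ∀ d, d₀ ≤ d → ∀ x : f.domain, (x : X) ∈ T d → f x ∈ N d}
    (by
      intro c hc hchain f₀ hf₀
      have hdir : DirectedOn (· ≤ ·) c := hchain.directedOn
      refine ⟨LinearPMap.sSup c hdir, ?_, fun f hf => LinearPMap.le_sSup hdir hf⟩
      rintro d hd ⟨x, hx⟩ hxT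
      obtain ⟨f, hfc, hxf⟩ := (LinearPMap.mem_domain_sSup_iff ⟨f₀, hf₀⟩ hdir).1 hx
      have := LinearPMap.sSup_apply hdir hfc ⟨x, hxf⟩
      exact this ▸ hc hfc d hd ⟨x, hxf⟩ hxT)
    (g.toPMap L) (fun d hd x hx => hg d hd x x.2 hx)
  have htop : f.domain = ⊤ := by
    by_contra hne
    -- the new vector is taken in the lowest step that is not yet covered
    obtain ⟨d, ⟨hd, x, hxT, hx⟩, hmin⟩ : ∃ d, (d₀ ≤ d ∧ ∃ x ∈ T d, x ∉ f.domain) ∧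
        ∀ d', (d₀ ≤ d' ∧ ∃ x ∈ T d', x ∉ f.domain) → d ≤ d' := by
      obtain ⟨x, hx⟩ : ∃ x, x ∉ f.domain := by
        by_contra hall
        push Not at hall
        exact hne (Submodule.eq_top_iff'.2 hall)
      obtain ⟨d, hd⟩ := hex x
      exact Int.exists_least_of_bdd ⟨d₀, fun z hz => hz.1⟩
        ⟨max d d₀, le_max_right _ _, x, hT (le_max_left _ _) hd, hx⟩
    have hle : f ≤ f.supSpanSingleton x 0 hx := LinearPMap.left_le_sup _ _ _
    have hmem : f.supSpanSingleton x 0 hx ∈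
        {f : X →ₗ.[F] Y | ∀ d, d₀ ≤ d → ∀ x : f.domain, (x : X) ∈ T d → f x ∈ N d} := by
      rintro d' hd' ⟨z, hz⟩ hzT
      have hz' := hz
      rw [LinearPMap.domain_supSpanSingleton, Submodule.mem_sup] at hz'
      obtain ⟨y, hy, w, hw, rfl⟩ := hz'
      obtain ⟨c, rfl⟩ := Submodule.mem_span_singleton.1 hw
      rw [LinearPMap.supSpanSingleton_apply_mk _ _ _ _ _ hy, smul_zero, add_zero]
      refine hf.1 d' hd' ⟨y, hy⟩ ?_
      rcases eq_or_ne c 0 with rfl | hc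
      · simpa using hzT
      have hdd' : d ≤ d' := by
        refine hmin d' ⟨hd', _, hzT, fun hmem => hx ?_⟩
        have h1 := f.domain.sub_mem hmem hy
        rw [add_sub_cancel_left] at h1
        simpa [hc] using f.domain.smul_mem c⁻¹ h1
      have h1 := (T d').sub_mem hzT ((T d').smul_mem c (hT hdd' hxT))
      rwa [add_sub_cancel_right] at h1
    have hback := hf.2 hmem hle
    refine hx (hback.1 ?_)
    rw [LinearPMap.domain_supSpanSingleton]
    exact Submodule.mem_sup_right (Submodule.mem_span_singleton_self x)
  have hall : ∀ x, x ∈ f.domain := fun x => htop ▸ Submodule.mem_top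
  refine ⟨f.toFun.comp (LinearMap.id.codRestrict f.domain hall), fun x hx => ?_,
    fun d hd x hx => hf.1 d hd ⟨x, hall x⟩ hx⟩
  exact (hLf.2 (x := ⟨x, hx⟩) (y := ⟨x, hall x⟩) rfl).symm

/-! ### Linear recurrences with operator coefficients -/

section recurrence

variable {F B : Type*} [Field F] [AddCommGroup B] [Module F B]

/-- The shift `(c_0, c_1, …) ↦ (c_s, c_{s+1}, …)` of sequences. -/
def seqShift (F : Type*) {B : Type*} [Field F] [AddCommGroup B] [Module F B] (s : ℕ) :
    (ℕ → B) →ₗ[F] (ℕ → B) :=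
  LinearMap.funLeft F B (· + s)

@[simp] theorem seqShift_apply (s : ℕ) (c : ℕ → B) (i : ℕ) : seqShift F s c i = c (i + s) := rfl

/-- For a polynomial `P = ∑ A_i X ^ i` whose coefficients are operators on `B`, the functional
`c ↦ ∑ A_i (c_i)` on sequences in `B`. -/
def evalSeq (P : (Module.End F B)[X]) : (ℕ → B) →ₗ[F] B :=
  P.sum fun i a => a.comp (LinearMap.proj i)

theorem evalSeq_eq_sum (P : (Module.End F B)[X]) {n : ℕ} (hn : P.natDegree < n) (c : ℕ → B) :
    evalSeq P c = ∑ i ∈ Finset.range n, P.coeff i (c i) := by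
  rw [evalSeq, sum_over_range' _ (by simp) n hn]
  simp [LinearMap.sum_apply]

theorem evalSeq_single (P : (Module.End F B)[X]) (i : ℕ) (y : B) :
    evalSeq P (Pi.single i y) = P.coeff i y := by
  rw [evalSeq_eq_sum P (n := max (P.natDegree + 1) (i + 1)) (by omega),
    Finset.sum_eq_single i]
  · simp
  · intro j _ hj
    simp [Pi.single_eq_of_ne hj]
  · intro h
    simp at h

theorem evalSeq_X_add_C_mul (P : (Module.End F B)[X]) (r : Module.End F B) (c : ℕ → B) :
    evalSeq ((X + C r) * P) c = evalSeq P (seqShift F 1 c) + r (evalSeq P c) := by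
  have h1 : ((X + C r) * P).natDegree < P.natDegree + 2 := by
    refine lt_of_le_of_lt natDegree_mul_le ?_
    have : (X + C r : (Module.End F B)[X]).natDegree ≤ 1 := by compute_degree
    omega
  rw [evalSeq_eq_sum _ h1, evalSeq_eq_sum P (n := P.natDegree + 1) (by omega),
    evalSeq_eq_sum P (n := P.natDegree + 2) (by omega) c]
  simp only [add_mul, coeff_add, coeff_C_mul, LinearMap.add_apply, Finset.sum_add_distrib,
    Module.End.mul_apply, map_sum]
  congr 1
  rw [Finset.sum_range_succ']
  simp [coeff_X_mul]

/-- A factorization `Q = (X + r) P` can be read off from the functionals. -/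
theorem eq_X_add_C_mul_of_evalSeq {P Q : (Module.End F B)[X]} {r : Module.End F B}
    (h : ∀ c, evalSeq Q c = evalSeq P (seqShift F 1 c) + r (evalSeq P c)) :
    Q = (X + C r) * P := by
  ext i y
  rw [← evalSeq_single, h, ← evalSeq_X_add_C_mul, evalSeq_single]

/-- The space of sequences `c` with `∑ A_i (c_{i + s}) = 0` for all `s`, where `P = ∑ A_i X ^ i`. -/
def solutions (P : (Module.End F B)[X]) : Submodule F (ℕ → B) :=
  ⨅ s : ℕ, LinearMap.ker ((evalSeq P).comp (seqShift F s))

theorem mem_solutions {P : (Module.End F B)[X]} {c : ℕ → B} :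
    c ∈ solutions P ↔ ∀ s, evalSeq P (seqShift F s c) = 0 := by
  simp [solutions]

theorem seqShift_seqShift (s t : ℕ) (c : ℕ → B) :
    seqShift F s (seqShift F t c) = seqShift F (s + t) c := by
  ext i
  simp [add_assoc]

theorem evalSeq_eq_zero {P : (Module.End F B)[X]} {c : ℕ → B} (hc : c ∈ solutions P) :
    evalSeq P c = 0 := mem_solutions.1 hc 0

theorem seqShift_mem_solutions {P : (Module.End F B)[X]} {c : ℕ → B} (hc : c ∈ solutions P)
    (s : ℕ) : seqShift F s c ∈ solutions P :=
  mem_solutions.2 fun t => by rw [seqShift_seqShift]; exact mem_solutions.1 hc _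

theorem solutions_le_of_eq_mul {P Q : (Module.End F B)[X]} {r : Module.End F B}
    (h : Q = (X + C r) * P) : solutions P ≤ solutions Q := by
  intro c hc
  rw [mem_solutions]
  intro s
  rw [h, evalSeq_X_add_C_mul, evalSeq_eq_zero (seqShift_mem_solutions hc s), seqShift_seqShift,
    evalSeq_eq_zero (seqShift_mem_solutions hc _), map_zero, add_zero]

/-- `P` is monic of degree `n`, in a form that also makes sense over the zero ring. -/
def IsMonicDeg {R : Type*} [Semiring R] (P : R[X]) (n : ℕ) : Prop :=
  P.natDegree ≤ n ∧ P.coeff n = 1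

theorem IsMonicDeg.evalSeq_eq {P : (Module.End F B)[X]} {n : ℕ} (hP : IsMonicDeg P n)
    (c : ℕ → B) : evalSeq P c = ∑ i ∈ Finset.range n, P.coeff i (c i) + c n := by
  rw [evalSeq_eq_sum P (Nat.lt_succ_of_le hP.1), Finset.sum_range_succ, hP.2]
  rfl

theorem IsMonicDeg.apply_eq {P : (Module.End F B)[X]} {n : ℕ} (hP : IsMonicDeg P n)
    {c : ℕ → B} (hc : c ∈ solutions P) (s : ℕ) :
    c (n + s) = -∑ i ∈ Finset.range n, P.coeff i (c (i + s)) := by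
  have h := mem_solutions.1 hc s
  rw [hP.evalSeq_eq] at h
  exact eq_neg_of_add_eq_zero_right h

/-- The solution of the recurrence `∑_{i ≤ n} A_i (c_{i + s}) = 0`, where `A_n = 1`, with initial
values `c_0, …, c_{n-1}`. -/
def solve (P : (Module.End F B)[X]) (n : ℕ) (c : ℕ → B) (i : ℕ) : B :=
  if _h : i < n then c i else -∑ l : Fin n, P.coeff l (solve P n c (i - n + l))
termination_by i
decreasing_by omega

theorem solve_of_lt (P : (Module.End F B)[X]) {n : ℕ} (c : ℕ → B) {i : ℕ} (h : i < n) :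
    solve P n c i = c i := by
  rw [solve, dif_pos h]

theorem solve_mem (P : (Module.End F B)[X]) {n : ℕ} (hP : IsMonicDeg P n) (c : ℕ → B) :
    solve P n c ∈ solutions P := by
  rw [mem_solutions]
  intro s
  rw [hP.evalSeq_eq, seqShift_apply, solve.eq_def P n c (n + s), dif_neg (by omega),
    Finset.sum_range fun i => P.coeff i (seqShift F s (solve P n c) i), add_neg_eq_zero]
  refine Finset.sum_congr rfl fun l _ => ?_
  rw [seqShift_apply, Nat.add_sub_cancel_left, add_comm]

end recurrence

/-! ### Triangular numbers -/

/-- The triangular number `0 + 1 + ⋯ + n`, as an integer. -/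
def tri : ℕ → ℤ
  | 0 => 0
  | n + 1 => tri n + (n + 1)

theorem tri_succ (n : ℕ) : tri (n + 1) = tri n + (n + 1) := rfl

theorem tri_add (m n : ℕ) : tri (m + n) = tri m + tri n + m * n := by
  induction n with
  | zero => simp [tri]
  | succ n ih =>
    rw [← add_assoc, tri_succ, tri_succ, ih]
    push_cast
    ring

theorem tri_shift_le {l n : ℕ} (h : l ≤ n) (s : ℕ) : tri (l + s) + tri n ≤ tri (n + s) + tri l := by
  have : (l : ℤ) * s ≤ n * s := by gcongr
  rw [tri_add, tri_add]
  linarith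

/-! ### Strictness of sums of solution spaces -/

/-- The properties of the algebra `B = T(V⁺) / R_gr` that are used to let `A(Γ)` act on it:
a filtration by degree, the classes `x v` of the vertices, and for `i ≤ |v|` the product
`β v i` of the classes of the vertices on levels `|v|, …, i + 1` of a path that starts at `v`. -/
structure SymbolAlgebra {V E : Type*} (G : LayeredGraph V E) (F B : Type*) [Field F] [Ring B]
    [Algebra F B] where
  fil : ℤ → Submodule F B
  fil_mono : Monotone fil
  exists_mem_fil : ∀ y, ∃ j, y ∈ fil j
  eq_zero_of_neg : ∀ {j : ℤ} {y : B}, j < 0 → y ∈ fil j → y = 0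
  x : V → B
  β : V → ℕ → B
  β_self : ∀ v, β v (G.level v) = 1
  β_edge : ∀ e i, i ≤ G.level (G.head e) → β (G.tail e) i = x (G.tail e) * β (G.head e) i
  x_mul_mem : ∀ {v : V} {j : ℤ} {y : B}, y ∈ fil j → x v * y ∈ fil (j + G.level v)
  β_mul_mem : ∀ {v : V} {i : ℕ} {j : ℤ} {y : B}, i ≤ G.level v → y ∈ fil j →
    β v i * y ∈ fil (j + tri (G.level v) - tri i)
  /-- A relation between the products `x v * y v` modulo lower terms is a consequence of the
  relations between the `β v i`. -/
  syzygy : ∀ (n : ℕ) (s : Finset V) (y : V → B) (D : ℤ), (∀ v ∈ s, G.level v = n + 1) →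
    (∀ v ∈ s, y v ∈ fil (D + tri n)) → ∑ v ∈ s, x v * y v ∈ fil (D + tri (n + 1) - 1) →
    ∀ v ∈ s, y v ∈ Submodule.span F {u | ∃ e e' i, ∃ t ∈ fil (D + tri i), G.tail e = v ∧
      G.tail e' = v ∧ i < n ∧ u = (β (G.head e) i - β (G.head e') i) * t} ⊔ fil (D + tri n - 1)

namespace SymbolAlgebra

variable {V E : Type*} {G : LayeredGraph V E} {F B : Type*} [Field F] [Ring B] [Algebra F B]
  (S : SymbolAlgebra G F B)

/-- The sequences `c` with `c_i` of degree at most `d + i (i + 1) / 2` for all `i < n`. -/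
def weightedBelow (n : ℕ) (d : ℤ) : Submodule F (ℕ → B) :=
  ⨅ i : ℕ, ⨅ _ : i < n, (S.fil (d + tri i)).comap (LinearMap.proj i)

/-- The sequences `c` with `c_i` of degree at most `d + i (i + 1) / 2` for all `i`. With these
weights the operator of multiplication by `β v i` on the `i`-th entry has the same degree for
all `i`. -/
def weighted (d : ℤ) : Submodule F (ℕ → B) :=
  ⨅ i : ℕ, (S.fil (d + tri i)).comap (LinearMap.proj i)

theorem mem_weightedBelow {n : ℕ} {d : ℤ} {c : ℕ → B} :
    c ∈ S.weightedBelow n d ↔ ∀ i < n, c i ∈ S.fil (d + tri i) := by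
  simp [weightedBelow]

theorem mem_weighted {d : ℤ} {c : ℕ → B} : c ∈ S.weighted d ↔ ∀ i, c i ∈ S.fil (d + tri i) := by
  simp [weighted]

theorem sum_β_mul {e : E} {n : ℕ} (hl : G.level (G.head e) = n) (c : ℕ → B) :
    ∑ i ∈ Finset.range (n + 1), S.β (G.tail e) i * c i =
      S.x (G.tail e) * (c n + ∑ i ∈ Finset.range n, S.β (G.head e) i * c i) := by
  subst hl
  rw [Finset.sum_range_succ, S.β_edge e _ le_rfl, S.β_self, mul_one, mul_add, Finset.mul_sum,
    add_comm]
  congr 1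
  exact Finset.sum_congr rfl fun i hi => by
    rw [S.β_edge e i (Finset.mem_range.1 hi).le, mul_assoc]

theorem weighted_le_weightedBelow (n : ℕ) (d : ℤ) : S.weighted d ≤ S.weightedBelow n d :=
  fun _ hc => S.mem_weightedBelow.2 fun i _ => S.mem_weighted.1 hc i

theorem weighted_mono : Monotone S.weighted := fun _ _ h _ hc =>
  S.mem_weighted.2 fun i => S.fil_mono (by linarith) (S.mem_weighted.1 hc i)

theorem weightedBelow_mono (n : ℕ) : Monotone (S.weightedBelow n) := fun _ _ h _ hc =>
  S.mem_weightedBelow.2 fun i hi => S.fil_mono (by linarith) (S.mem_weightedBelow.1 hc i hi)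

theorem exists_mem_weightedBelow (n : ℕ) (c : ℕ → B) (d₀ : ℤ) :
    ∃ k : ℕ, c ∈ S.weightedBelow n (d₀ + k) := by
  induction n with
  | zero => exact ⟨0, S.mem_weightedBelow.2 fun i hi => absurd hi (by omega)⟩
  | succ n ih =>
    obtain ⟨k, hk⟩ := ih
    obtain ⟨j, hj⟩ := S.exists_mem_fil (c n)
    refine ⟨max k (j - tri n - d₀).toNat, S.mem_weightedBelow.2 fun i hi => ?_⟩
    rcases Nat.lt_succ_iff_lt_or_eq.1 hi with hi | rfl
    · refine S.fil_mono ?_ (S.mem_weightedBelow.1 hk i hi)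
      push_cast
      have := le_max_left (k : ℤ) ((j - tri n - d₀).toNat : ℤ)
      linarith
    · refine S.fil_mono ?_ hj
      push_cast
      have := le_max_right (k : ℤ) ((j - tri i - d₀).toNat : ℤ)
      have := Int.self_le_toNat (j - tri i - d₀)
      linarith

/-- The polynomial `P v` with operator coefficients is an admissible deformation of
`∑ (β v i) X ^ i`: its coefficients are the multiplications by the `β v i` up to terms of lower
degree, and for each edge `e` from `v` to `w` it is divisible by `P w` with a monic linear
quotient. -/
structure IsLift (P : V → (Module.End F B)[X]) (v : V) : Prop where
  monic : IsMonicDeg (P v) (G.level v)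
  symbol : ∀ i ≤ G.level v, ∀ (j : ℤ), ∀ y ∈ S.fil j,
    (P v).coeff i y - S.β v i * y ∈ S.fil (j + tri (G.level v) - tri i - 1)
  edge : ∀ e, G.tail e = v → ∃ r, P v = (X + C r) * P (G.head e)

section lift

variable {S} {P : V → (Module.End F B)[X]}

theorem IsLift.coeff_mem {v : V} (h : S.IsLift P v) {i : ℕ} (hi : i ≤ G.level v) {j : ℤ} {y : B}
    (hy : y ∈ S.fil j) : (P v).coeff i y ∈ S.fil (j + tri (G.level v) - tri i) := by
  have := (S.fil _).add_mem (S.fil_mono (by linarith) (h.symbol i hi j y hy))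
    (S.β_mul_mem hi hy)
  rwa [sub_add_cancel] at this

/-- A solution is bounded as soon as its initial values are. -/
theorem IsLift.mem_weighted {v : V} (h : S.IsLift P v) {c : ℕ → B} (hc : c ∈ solutions (P v))
    {d : ℤ} (hd : c ∈ S.weightedBelow (G.level v) d) : c ∈ S.weighted d := by
  rw [S.mem_weighted]
  intro i
  induction i using Nat.strong_induction_on with
  | _ i ih =>
    rcases lt_or_ge i (G.level v) with hi | hi
    · exact S.mem_weightedBelow.1 hd i hi
    · obtain ⟨s, rfl⟩ := Nat.exists_eq_add_of_le hi
      rw [h.monic.apply_eq hc]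
      refine neg_mem (sum_mem fun l hl => ?_)
      have hl' := Finset.mem_range.1 hl
      refine S.fil_mono ?_ (h.coeff_mem hl'.le (ih (l + s) (by omega)))
      linarith [tri_shift_le hl'.le s]

/-- The first entry after the initial values has its expected leading term. -/
theorem IsLift.apply_level_add_mem {v : V} (h : S.IsLift P v) {c : ℕ → B}
    (hc : c ∈ solutions (P v)) {d : ℤ} (hd : c ∈ S.weightedBelow (G.level v) d) :
    c (G.level v) + ∑ i ∈ Finset.range (G.level v), S.β v i * c i ∈
      S.fil (d + tri (G.level v) - 1) := by
  have := h.monic.apply_eq hc 0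
  simp only [add_zero] at this
  rw [this, neg_add_eq_sub, ← Finset.sum_sub_distrib]
  refine sum_mem fun i hi => ?_
  have hi' := Finset.mem_range.1 hi
  have := neg_mem (h.symbol i hi'.le _ _ (S.mem_weightedBelow.1 hd i hi'))
  rw [neg_sub] at this
  exact S.fil_mono (by linarith) this

/-- The second entry after the initial values is of lower degree than expected. -/
theorem IsLift.apply_level_succ_mem {v : V} (h : S.IsLift P v) {c : ℕ → B}
    (hc : c ∈ solutions (P v)) {d : ℤ} (hd : c ∈ S.weighted d) :
    c (G.level v + 1) ∈ S.fil (d + tri (G.level v + 1) - 1) := by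
  rw [h.monic.apply_eq hc 1]
  refine neg_mem (sum_mem fun i hi => ?_)
  have hi' := Finset.mem_range.1 hi
  refine S.fil_mono ?_ (h.coeff_mem hi'.le (S.mem_weighted.1 hd (i + 1)))
  rw [tri_succ, tri_succ]
  have : (i : ℤ) + 1 ≤ G.level v := by exact_mod_cast hi'
  linarith

end lift

end SymbolAlgebra

/-- The heads of the edges whose tails lie in `U`. -/
def LayeredGraph.children {V E : Type*} (G : LayeredGraph V E) (U : Set V) : Set V :=
  {z | ∃ e, G.tail e ∈ U ∧ G.head e = z}

namespace SymbolAlgebra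

variable {V E : Type*} {G : LayeredGraph V E} {F B : Type*} [Field F] [Ring B] [Algebra F B]
  {S : SymbolAlgebra G F B} {P : V → (Module.End F B)[X]}

theorem level_head {e : E} {n : ℕ} (h : G.level (G.tail e) = n + 1) : G.level (G.head e) = n := by
  have := G.level_tail e
  omega

theorem iSup_children_le {U : Set V} (hP : ∀ v ∈ U, S.IsLift P v) (W : Submodule F (ℕ → B)) :
    ⨆ z ∈ G.children U, solutions (P z) ⊓ W ≤ ⨆ w ∈ U, solutions (P w) ⊓ W := by
  refine iSup₂_le fun z hz => ?_
  obtain ⟨e, he, rfl⟩ := hz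
  obtain ⟨r, hr⟩ := (hP _ he).edge e rfl
  exact le_trans (inf_le_inf_right W (solutions_le_of_eq_mul hr))
    (le_iSup₂ (f := fun w _ => solutions (P w) ⊓ W) (G.tail e) he)

/-- Modulo lower terms, sums of solutions at the children of `w` realize every sequence
concentrated on level `|w| - 1` whose value there is a syzygy. -/
theorem single_mem_of_mem_span {w : V} {n : ℕ} (hw : G.level w = n + 1)
    (hP : ∀ e, G.tail e = w → S.IsLift P (G.head e)) {D : ℤ} {u : B}
    (hu : u ∈ Submodule.span F {u | ∃ e e' i, ∃ t ∈ S.fil (D + tri i), G.tail e = w ∧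
      G.tail e' = w ∧ i < n ∧ u = (S.β (G.head e) i - S.β (G.head e') i) * t} ⊔
        S.fil (D + tri n - 1)) :
    Pi.single n u ∈ (⨆ z ∈ G.children {w}, solutions (P z) ⊓ S.weighted D) ⊔
      S.weightedBelow (n + 1) (D - 1) := by
  set N := (⨆ z ∈ G.children {w}, solutions (P z) ⊓ S.weighted D) ⊔
      S.weightedBelow (n + 1) (D - 1) with hN
  suffices h : Submodule.span F {u | ∃ e e' i, ∃ t ∈ S.fil (D + tri i), G.tail e = w ∧
      G.tail e' = w ∧ i < n ∧ u = (S.β (G.head e) i - S.β (G.head e') i) * t} ⊔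
        S.fil (D + tri n - 1) ≤ N.comap (LinearMap.single F (fun _ => B) n) from h hu
  refine sup_le (Submodule.span_le.2 ?_) fun y hy => Submodule.mem_sup_right ?_
  swap
  · rw [S.mem_weightedBelow]
    intro i hi
    rcases Nat.lt_succ_iff_lt_or_eq.1 hi with hi | rfl
    · simp [Pi.single_eq_of_ne hi.ne]
    · simpa using S.fil_mono (by linarith) hy
  rintro _ ⟨e, e', i, t, ht, he, he', hi, rfl⟩
  -- the difference of the two solutions with the single initial value `t` at `i`
  have key : ∀ e, G.tail e = w → ∃ c ∈ ⨆ z ∈ G.children {w}, solutions (P z) ⊓ S.weighted D,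
      (∀ l < n, c l = Pi.single (M := fun _ => B) i t l) ∧
        c n + S.β (G.head e) i * t ∈ S.fil (D + tri n - 1) := by
    intro e he
    have hl : G.level (G.head e) = n := level_head (he ▸ hw)
    have hlift := hP e he
    have hmon := hlift.monic
    rw [hl] at hmon
    have hsol := solve_mem (P (G.head e)) hmon (Pi.single i t)
    have hval : ∀ l < n, solve (P (G.head e)) n (Pi.single i t) l =
        Pi.single (M := fun _ => B) i t l := fun l hl => solve_of_lt _ _ hl
    have hbd : solve (P (G.head e)) n (Pi.single i t) ∈ S.weightedBelow n D := by
      rw [S.mem_weightedBelow]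
      intro l hl
      rw [hval l hl]
      rcases eq_or_ne l i with rfl | hli
      · simpa using ht
      · simp [Pi.single_eq_of_ne hli]
    have hlead := hlift.apply_level_add_mem hsol (by rw [hl]; exact hbd)
    rw [hl, Finset.sum_eq_single i, hval i hi, Pi.single_eq_same] at hlead
    · exact ⟨_, Submodule.mem_iSup_of_mem _ (Submodule.mem_iSup_of_mem ⟨e, he, rfl⟩
        ⟨hsol, hlift.mem_weighted hsol (by rw [hl]; exact hbd)⟩), hval, hlead⟩
    · intro l hl hli
      rw [hval l (Finset.mem_range.1 hl), Pi.single_eq_of_ne hli, mul_zero]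
    · exact fun h => absurd (Finset.mem_range.2 hi) h
  obtain ⟨c, hc, hcv, hcn⟩ := key e he
  obtain ⟨c', hc', hcv', hcn'⟩ := key e' he'
  refine Submodule.mem_sup.2 ⟨c' - c, sub_mem hc' hc,
    Pi.single n ((S.β (G.head e) i - S.β (G.head e') i) * t) - (c' - c), ?_, by simp⟩
  rw [S.mem_weightedBelow]
  intro l hl
  rcases Nat.lt_succ_iff_lt_or_eq.1 hl with hl | rfl
  · simp [Pi.single_eq_of_ne hl.ne, hcv l hl, hcv' l hl]
  · have h := sub_mem hcn hcn'
    refine S.fil_mono (by linarith) (?_ : _ ∈ S.fil (D + tri l - 1))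
    convert h using 1
    simp only [Pi.sub_apply, Pi.single_eq_same, sub_mul]
    abel

/-- A sequence that satisfies the recurrence at `w` to leading order is, modulo lower terms, a sum
of solutions at the children of `w`, provided that the obvious obstruction is a syzygy. -/
theorem mem_iSup_children_sup {w : V} {n : ℕ} (hw : G.level w = n + 1)
    (hP : ∀ e, G.tail e = w → S.IsLift P (G.head e)) {e : E} (he : G.tail e = w) {D : ℤ}
    {c : ℕ → B} (hc : c ∈ S.weightedBelow n D)
    (hu : c n + ∑ i ∈ Finset.range n, S.β (G.head e) i * c i ∈
      Submodule.span F {u | ∃ e e' i, ∃ t ∈ S.fil (D + tri i), G.tail e = w ∧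
      G.tail e' = w ∧ i < n ∧ u = (S.β (G.head e) i - S.β (G.head e') i) * t} ⊔
        S.fil (D + tri n - 1)) :
    c ∈ (⨆ z ∈ G.children {w}, solutions (P z) ⊓ S.weighted D) ⊔
      S.weightedBelow (n + 1) (D - 1) := by
  have hl : G.level (G.head e) = n := level_head (he ▸ hw)
  have hlift := hP e he
  have hmon := hlift.monic
  rw [hl] at hmon
  have hsol := solve_mem (P (G.head e)) hmon c
  have hval : ∀ l < n, solve (P (G.head e)) n c l = c l := fun l hl => solve_of_lt _ _ hl
  set a := solve (P (G.head e)) n c with ha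
  have hbd : a ∈ S.weightedBelow n D := S.mem_weightedBelow.2 fun l hl => by
    rw [hval l hl]; exact S.mem_weightedBelow.1 hc l hl
  have hlead := hlift.apply_level_add_mem hsol (by rw [hl]; exact hbd)
  rw [hl, Finset.sum_congr rfl fun l hl => by rw [hval l (Finset.mem_range.1 hl)]] at hlead
  have haN := Submodule.mem_sup_left (T := S.weightedBelow (n + 1) (D - 1))
    (Submodule.mem_iSup_of_mem (p := fun z => ⨆ _ : z ∈ G.children {w}, solutions (P z) ⊓
      S.weighted D) (G.head e) (Submodule.mem_iSup_of_mem ⟨e, he, rfl⟩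
        ⟨hsol, hlift.mem_weighted hsol (by rw [hl]; exact hbd)⟩))
  have hdiff : c n - a n ∈ Submodule.span F {u | ∃ e e' i, ∃ t ∈ S.fil (D + tri i), G.tail e = w ∧
      G.tail e' = w ∧ i < n ∧ u = (S.β (G.head e) i - S.β (G.head e') i) * t} ⊔
        S.fil (D + tri n - 1) := by
    have := sub_mem hu (Submodule.mem_sup_right hlead)
    rwa [add_sub_add_right_eq_sub] at this
  have hsingle := single_mem_of_mem_span hw hP hdiff
  have hrest : c - a - Pi.single n (c n - a n) ∈ S.weightedBelow (n + 1) (D - 1) := by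
    rw [S.mem_weightedBelow]
    intro l hl
    rcases Nat.lt_succ_iff_lt_or_eq.1 hl with hl | rfl
    · simp [Pi.single_eq_of_ne hl.ne, hval l hl]
    · simp
  have := add_mem (add_mem haN hsingle) (Submodule.mem_sup_right hrest)
  convert this using 1
  abel

/-- Strictness: if a sum of solutions at vertices of level `n` is bounded by `d` in its first
`n + 1` entries, then it is a sum of solutions that are individually bounded by `d`. -/
theorem iSup_solutions_inf_le (hout : ∀ v, 0 < G.level v → ∃ e, G.tail e = v) {n : ℕ}
    (hP : ∀ v, G.level v ≤ n → S.IsLift P v) {U : Set V} (hU : ∀ v ∈ U, G.level v = n) (d : ℤ) :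
    (⨆ w ∈ U, solutions (P w)) ⊓ S.weightedBelow (n + 1) d ≤
      ⨆ w ∈ U, solutions (P w) ⊓ S.weighted d := by
  induction n generalizing U d with
  | zero =>
    refine inf_le_left.trans (iSup₂_le fun w hw c hc => ?_)
    have h := (hP w (hU w hw).le).monic.apply_eq hc
    have : c = 0 := by
      ext s
      simpa [hU w hw] using h s
    rw [this]
    exact zero_mem _
  | succ n ih =>
    have step : ∀ D : ℤ, (⨆ w ∈ U, solutions (P w) ⊓ S.weighted D) ⊓
        S.weightedBelow (n + 2) (D - 1) ≤ ⨆ w ∈ U, solutions (P w) ⊓ S.weighted (D - 1) := by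
      rintro D x ⟨hx, hxD⟩
      obtain ⟨f, hf, rfl⟩ := (Submodule.mem_iSup_iff_exists_finsupp _ _).1 hx
      have hfU : ∀ w ∈ f.support, w ∈ U := by
        intro w hw
        by_contra hwU
        have := hf w
        simp only [hwU, iSup_false, Submodule.mem_bot] at this
        exact Finsupp.mem_support_iff.1 hw this
      have hfm : ∀ w ∈ f.support, f w ∈ solutions (P w) ∧ f w ∈ S.weighted D := by
        intro w hw
        simpa [hfU w hw] using hf w
      have hlev : ∀ w ∈ f.support, G.level w = n + 1 := fun w hw => hU w (hfU w hw)
      rcases isEmpty_or_nonempty E with hE | hE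
      · rw [Finsupp.sum, Finset.sum_eq_zero]
        · exact zero_mem _
        · exact fun w hw => (hout w (by rw [hlev w hw]; omega)).elim fun e _ => isEmptyElim e
      choose! e he using fun w (hw : w ∈ f.support) => hout w (by rw [hlev w hw]; omega)
      have hlevh : ∀ w ∈ f.support, G.level (G.head (e w)) = n := fun w hw =>
        level_head ((he w hw).symm ▸ hlev w hw)
      set y : V → B := fun w => f w n + ∑ i ∈ Finset.range n, S.β (G.head (e w)) i * f w i with hy
      have hxy : ∀ w ∈ f.support, S.x w * y w = ∑ i ∈ Finset.range (n + 1), S.β w i * f w i := by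
        intro w hw
        have := S.sum_β_mul (hlevh w hw) (f w)
        rw [he w hw] at this
        exact this.symm
      have hsyz := S.syzygy n f.support y D hlev
        (by
          intro w hw
          refine add_mem (S.mem_weighted.1 (hfm w hw).2 n) (sum_mem fun i hi => ?_)
          have hi' := Finset.mem_range.1 hi
          have := S.β_mul_mem (v := G.head (e w)) (i := i) (by rw [hlevh w hw]; exact hi'.le)
            (S.mem_weighted.1 (hfm w hw).2 i)
          rw [hlevh w hw] at this
          exact S.fil_mono (by linarith) this)
        (by
          have h1 := S.mem_weightedBelow.1 hxD (n + 1) (by omega)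
          have h2 : ∑ w ∈ f.support, (f w (n + 1) + S.x w * y w) ∈
              S.fil (D + tri (n + 1) - 1) := by
            refine sum_mem fun w hw => ?_
            have := (hP w (hlev w hw).le).apply_level_add_mem (hfm w hw).1
              (S.weighted_le_weightedBelow _ _ (hfm w hw).2)
            rwa [hlev w hw, ← hxy w hw] at this
          rw [Finset.sum_add_distrib] at h2
          have h3 : (f.sum fun _ c => c) (n + 1) = ∑ w ∈ f.support, f w (n + 1) := by
            rw [Finsupp.sum, Finset.sum_apply]
          rw [h3] at h1
          have := sub_mem h2 (S.fil_mono (by linarith) h1)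
          rwa [add_sub_cancel_left] at this)
      have hmem : (f.sum fun _ c => c) ∈ (⨆ z ∈ G.children U, solutions (P z) ⊓ S.weighted D) ⊔
          ⨆ w ∈ U, solutions (P w) ⊓ S.weighted (D - 1) := by
        refine sum_mem fun w hw => ?_
        have hwU := hfU w hw
        have h1 := mem_iSup_children_sup (hlev w hw)
          (fun e he => hP _ (by rw [level_head (he.symm ▸ hlev w hw)]; omega)) (he w hw)
          (S.weighted_le_weightedBelow n D (hfm w hw).2) (hsyz w hw)
        obtain ⟨a, ha, b, hb, hab⟩ := Submodule.mem_sup.1 h1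
        have ha' : a ∈ solutions (P w) := by
          have := iSup_children_le (U := {w}) (fun v hv => hP v (by
            rw [Set.mem_singleton_iff.1 hv, hlev w hw])) _ ha
          simp only [Set.mem_singleton_iff, iSup_iSup_eq_left] at this
          exact this.1
        have hb' : b ∈ solutions (P w) := by
          rw [← add_sub_cancel_left a b, hab]
          exact sub_mem (hfm w hw).1 ha'
        have hch : ⨆ z ∈ G.children {w}, solutions (P z) ⊓ S.weighted D ≤
            ⨆ z ∈ G.children U, solutions (P z) ⊓ S.weighted D := by
          refine biSup_mono ?_
          rintro _ ⟨e, he, rfl⟩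
          exact ⟨e, (Set.mem_singleton_iff.1 he).symm ▸ hwU, rfl⟩
        rw [← hab]
        refine add_mem (Submodule.mem_sup_left (hch ha)) (Submodule.mem_sup_right ?_)
        refine Submodule.mem_iSup_of_mem w (Submodule.mem_iSup_of_mem hwU ⟨hb', ?_⟩)
        exact (hP w (hlev w hw).le).mem_weighted hb' (by rw [hlev w hw]; exact hb)
      obtain ⟨a, ha, b, hb, hab⟩ := Submodule.mem_sup.1 hmem
      rw [← hab] at hxD ⊢
      refine add_mem (iSup_children_le (fun v hv => hP v (hU v hv).le) _ (ih
        (fun v hv => hP v (hv.trans n.le_succ)) ?_ (D - 1) ⟨?_, ?_⟩)) hb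
      · rintro _ ⟨e, he, rfl⟩
        exact level_head (hU _ he)
      · have hle : ⨆ z ∈ G.children U, solutions (P z) ⊓ S.weighted D ≤
            ⨆ z ∈ G.children U, solutions (P z) := iSup₂_mono fun _ _ => inf_le_left
        exact hle ha
      · have hb' : b ∈ S.weighted (D - 1) := by
          have : ⨆ w ∈ U, solutions (P w) ⊓ S.weighted (D - 1) ≤ S.weighted (D - 1) :=
            iSup₂_le fun _ _ => inf_le_right
          exact this hb
        have hb'' := S.weighted_le_weightedBelow (n + 1) _ hb'
        have h1 : a + b ∈ S.weightedBelow (n + 1) (D - 1) :=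
          S.mem_weightedBelow.2 fun i hi => S.mem_weightedBelow.1 hxD i (by omega)
        have := sub_mem h1 hb''
        rwa [add_sub_cancel_right] at this
    have descend : ∀ k : ℕ, (⨆ w ∈ U, solutions (P w) ⊓ S.weighted (d + k)) ⊓
        S.weightedBelow (n + 2) d ≤ ⨆ w ∈ U, solutions (P w) ⊓ S.weighted d := by
      intro k
      induction k with
      | zero => simp
      | succ k ihk =>
        rintro x ⟨hx, hxd⟩
        refine ihk ⟨?_, hxd⟩
        have h1 : d + ((k + 1 : ℕ) : ℤ) - 1 = d + k := by push_cast; ring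
        have := step (d + (k + 1 : ℕ)) ⟨hx, S.weightedBelow_mono _ (by rw [h1]; simp) hxd⟩
        rwa [h1] at this
    rintro x ⟨hx, hxd⟩
    have : ∃ k : ℕ, x ∈ ⨆ w ∈ U, solutions (P w) ⊓ S.weighted (d + k) := by
      have hmono : Monotone fun k : ℕ => ⨆ w ∈ U, solutions (P w) ⊓ S.weighted (d + k) :=
        fun k l hkl => iSup₂_mono fun _ _ =>
          inf_le_inf_left _ (S.weighted_mono (by simpa using hkl))
      have hle : ⨆ w ∈ U, solutions (P w) ≤
          ⨆ k : ℕ, ⨆ w ∈ U, solutions (P w) ⊓ S.weighted (d + k) := by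
        refine iSup₂_le fun w hw c hc => ?_
        obtain ⟨k, hk⟩ := S.exists_mem_weightedBelow (n + 1) c d
        refine Submodule.mem_iSup_of_mem k (Submodule.mem_iSup_of_mem w
          (Submodule.mem_iSup_of_mem hw ⟨hc, ?_⟩))
        exact (hP w (hU w hw).le).mem_weighted hc (by rw [hU w hw]; exact hk)
      exact (Submodule.mem_iSup_of_directed _ hmono.directed_le).1 (hle hx)
    obtain ⟨k, hk⟩ := this
    exact descend k ⟨hk, hxd⟩

end SymbolAlgebra

/-! ### Construction of the deformation, level by level -/

namespace SymbolAlgebra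

variable {V E : Type*} {G : LayeredGraph V E} {F B : Type*} [Field F] [Ring B] [Algebra F B]
  {S : SymbolAlgebra G F B} {P : V → (Module.End F B)[X]}

/-- A monic polynomial that annihilates all solutions of a monic `P` of degree one less is a
multiple `(X + r) P`. -/
theorem exists_eq_X_add_C_mul {Q R : (Module.End F B)[X]} {n : ℕ} (hR : IsMonicDeg R n)
    (hQ : IsMonicDeg Q (n + 1)) (h : ∀ c ∈ solutions R, evalSeq Q c = 0) :
    ∃ r, Q = (X + C r) * R := by
  refine ⟨(evalSeq Q - (evalSeq R).comp (seqShift F 1)).comp (LinearMap.single F (fun _ => B) n),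
    eq_X_add_C_mul_of_evalSeq fun c => ?_⟩
  -- split off the solution of `R` with the initial values of `c`
  obtain ⟨a, u, ha, hu, rfl⟩ : ∃ a u, a ∈ solutions R ∧ (∀ i < n, u i = 0) ∧ a + u = c :=
    ⟨solve R n c, c - solve R n c, solve_mem R hR c,
      fun i hi => by simp [solve_of_lt R c hi], by abel⟩
  simp only [map_add, h a ha, evalSeq_eq_zero ha, evalSeq_eq_zero (seqShift_mem_solutions ha 1),
    zero_add]
  have h1 : evalSeq R u = u n := by
    rw [hR.evalSeq_eq, Finset.sum_eq_zero, zero_add]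
    intro i hi
    rw [hu i (Finset.mem_range.1 hi), map_zero]
  have h2 : evalSeq Q u = evalSeq Q (Pi.single n (u n)) + u (n + 1) := by
    rw [evalSeq_single, hQ.evalSeq_eq, Finset.sum_range_succ, Finset.sum_eq_zero, zero_add]
    intro i hi
    rw [hu i (Finset.mem_range.1 hi), map_zero]
  have h3 : evalSeq R (seqShift F 1 u) =
      evalSeq R (seqShift F 1 (Pi.single n (u n))) + u (n + 1) := by
    rw [hR.evalSeq_eq, hR.evalSeq_eq]
    simp only [seqShift_apply]
    rw [Pi.single_eq_of_ne (by omega : n + 1 ≠ n), add_zero]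
    congr 1
    refine Finset.sum_congr rfl fun i hi => ?_
    have hi' := Finset.mem_range.1 hi
    rcases eq_or_ne (i + 1) n with hin | hin
    · rw [hin, Pi.single_eq_same]
    · rw [Pi.single_eq_of_ne hin, hu (i + 1) (by omega)]
  rw [h1, h2, h3]
  simp only [LinearMap.comp_apply, LinearMap.sub_apply, LinearMap.coe_single]
  abel

/-- Extension of a deformation to a vertex on the next level. -/
theorem exists_lift_at (hout : ∀ v, 0 < G.level v → ∃ e, G.tail e = v) {n : ℕ}
    (hP : ∀ v, G.level v ≤ n → S.IsLift P v) {v : V} (hv : G.level v = n + 1) :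
    ∃ Q : (Module.End F B)[X], IsMonicDeg Q (n + 1) ∧
      (∀ i ≤ n + 1, ∀ (j : ℤ), ∀ y ∈ S.fil j,
        Q.coeff i y - S.β v i * y ∈ S.fil (j + tri (n + 1) - tri i - 1)) ∧
      ∀ e, G.tail e = v → ∃ r, Q = (X + C r) * P (G.head e) := by
  have hlev : ∀ e, G.tail e = v → G.level (G.head e) = n := fun e he => level_head (he ▸ hv)
  set g : (ℕ → B) →ₗ[F] B := LinearMap.proj (n + 1) +
    ∑ i ∈ Finset.range (n + 1), (LinearMap.mulLeft F (S.β v i)).comp (LinearMap.proj i) with hg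
  have hgc : ∀ c, g c = c (n + 1) + ∑ i ∈ Finset.range (n + 1), S.β v i * c i := fun c => by
    simp [hg, LinearMap.sum_apply]
  obtain ⟨h, hhL, hhT⟩ := exists_filtered_extension (S.weightedBelow (n + 1))
    (fun d => S.fil (d + tri (n + 1) - 1)) (S.weightedBelow_mono (n + 1))
    (fun c => (S.exists_mem_weightedBelow (n + 1) c 0).imp' _ fun _ h => h) (-tri (n + 1))
    (⨆ z ∈ G.children {v}, solutions (P z)) g
    (by
      intro d _ c hcL hcT
      have hmem := iSup_solutions_inf_le hout hP (U := G.children {v})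
        (by rintro _ ⟨e, he, rfl⟩; exact hlev e he) d ⟨hcL, hcT⟩
      suffices hle : ⨆ z ∈ G.children {v}, solutions (P z) ⊓ S.weighted d ≤
          (S.fil (d + tri (n + 1) - 1)).comap g from hle hmem
      refine iSup₂_le ?_
      rintro _ ⟨e, he, rfl⟩ a ⟨ha, had⟩
      have hl := hlev e he
      have hlift := hP _ hl.le
      have h1 := hlift.apply_level_succ_mem ha had
      have h2 := hlift.apply_level_add_mem ha (S.weighted_le_weightedBelow _ _ had)
      rw [hl] at h1 h2
      have h3 : ∑ i ∈ Finset.range (n + 1), S.β v i * a i =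
          S.x v * (a n + ∑ i ∈ Finset.range n, S.β (G.head e) i * a i) := by
        have := S.sum_β_mul hl a
        rwa [Set.mem_singleton_iff.1 he] at this
      rw [Submodule.mem_comap, hgc, h3]
      refine add_mem h1 (S.fil_mono ?_ (S.x_mul_mem h2))
      rw [hv, tri_succ]
      push_cast
      linarith)
  have hh0 : ∀ c : ℕ → B, (∀ i < n + 1, c i = 0) → h c = 0 := by
    intro c hc
    refine S.eq_zero_of_neg (j := -1) (by norm_num) (S.fil_mono ?_ (hhT (-tri (n + 1)) le_rfl c ?_))
    · linarith
    · exact S.mem_weightedBelow.2 fun i hi => by rw [hc i hi]; exact zero_mem _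
  have hhT' : ∀ d, ∀ c ∈ S.weightedBelow (n + 1) d, h c ∈ S.fil (d + tri (n + 1) - 1) := by
    intro d c hc
    rcases le_or_gt (-tri (n + 1)) d with hd | hd
    · exact hhT d hd c hc
    · have hc0 := S.weightedBelow_mono (n + 1) hd.le hc
      have := S.eq_zero_of_neg (j := -1) (by norm_num)
        (S.fil_mono (by linarith) (hhT _ le_rfl c hc0))
      rw [this]
      exact zero_mem _
  have hhsum : ∀ c : ℕ → B, h c = ∑ i ∈ Finset.range (n + 1), h (Pi.single i (c i)) := by
    intro c
    rw [← map_sum, ← sub_eq_zero, ← map_sub]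
    refine hh0 _ fun i hi => ?_
    rw [Pi.sub_apply, Finset.sum_apply, Finset.sum_eq_single i, Pi.single_eq_same, sub_self]
    · exact fun j _ hj => Pi.single_eq_of_ne hj.symm _
    · exact fun hi' => absurd (Finset.mem_range.2 hi) hi'
  set A : ℕ → Module.End F B := fun i =>
    LinearMap.mulLeft F (S.β v i) - h.comp (LinearMap.single F (fun _ => B) i) with hA
  set Q : (Module.End F B)[X] := X ^ (n + 1) + ∑ i ∈ Finset.range (n + 1), monomial i (A i) with hQ
  have hcoeff : ∀ i < n + 1, Q.coeff i = A i := by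
    intro i hi
    rw [hQ, coeff_add, coeff_X_pow, if_neg hi.ne, zero_add, finsetSum_coeff,
      Finset.sum_eq_single i, coeff_monomial_same]
    · exact fun j _ hj => coeff_monomial_of_ne _ hj.symm
    · exact fun hi' => absurd (Finset.mem_range.2 hi) hi'
  have hmon : IsMonicDeg Q (n + 1) := by
    constructor
    · refine natDegree_add_le_of_degree_le (natDegree_X_pow_le _) ?_
      refine natDegree_sum_le_of_forall_le _ _ fun i hi => ?_
      exact (natDegree_monomial_le _).trans (Finset.mem_range.1 hi).le
    · rw [hQ, coeff_add, coeff_X_pow_self, finsetSum_coeff, Finset.sum_eq_zero, add_zero]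
      exact fun i hi => coeff_monomial_of_ne _ (Finset.mem_range.1 hi).ne'
  have heval : ∀ c, evalSeq Q c = g c - h c := by
    intro c
    rw [hmon.evalSeq_eq, hgc, hhsum, add_sub_assoc, ← Finset.sum_sub_distrib, add_comm]
    congr 1
    refine Finset.sum_congr rfl fun i hi => ?_
    rw [hcoeff i (Finset.mem_range.1 hi)]
    simp [hA]
  refine ⟨Q, hmon, fun i hi j y hy => ?_, fun e he => ?_⟩
  · rcases Nat.lt_or_eq_of_le hi with hi | rfl
    · rw [hcoeff i hi]
      simp only [hA, LinearMap.sub_apply, LinearMap.mulLeft_apply, LinearMap.comp_apply,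
        LinearMap.coe_single, sub_sub_cancel_left]
      refine neg_mem (S.fil_mono ?_ (hhT' (j - tri i) _ ?_))
      · linarith
      · rw [S.mem_weightedBelow]
        intro l _
        rcases eq_or_ne l i with rfl | hl
        · simpa using hy
        · simp [Pi.single_eq_of_ne hl]
    · have := S.β_self v
      rw [hv] at this
      rw [hmon.2, this, one_mul, Module.End.one_apply, sub_self]
      exact zero_mem _
  · have hmonP := (hP _ (hlev e he).le).monic
    rw [hlev e he] at hmonP
    refine exists_eq_X_add_C_mul hmonP hmon fun c hc => ?_
    rw [heval, hhL c, sub_self]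
    exact Submodule.mem_iSup_of_mem _ (Submodule.mem_iSup_of_mem ⟨e, he, rfl⟩ hc)

theorem exists_lift_le (S : SymbolAlgebra G F B)
    (hout : ∀ v, 0 < G.level v → ∃ e, G.tail e = v) (n : ℕ) :
    ∃ P : V → (Module.End F B)[X], ∀ v, G.level v ≤ n → S.IsLift P v := by
  induction n with
  | zero =>
    refine ⟨fun _ => 1, fun v hv => ?_⟩
    have hv0 : G.level v = 0 := by omega
    refine ⟨?_, fun i hi j y _ => ?_, fun e he => ?_⟩
    · rw [hv0]
      exact ⟨by simp, by simp⟩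
    · have hi0 : i = 0 := by omega
      have := S.β_self v
      rw [hv0] at this
      subst hi0
      simp [this]
    · have := G.level_tail e
      rw [he] at this
      omega
  | succ n ih =>
    classical
    obtain ⟨P, hP⟩ := ih
    choose! Q hQmon hQsym hQedge using fun v (hv : G.level v = n + 1) => exists_lift_at hout hP hv
    refine ⟨fun v => if G.level v = n + 1 then Q v else P v, fun v hv => ?_⟩
    have hedge : ∀ e, G.tail e = v → (if G.level (G.head e) = n + 1 then Q (G.head e) else
        P (G.head e)) = P (G.head e) := by
      intro e he
      have := G.level_tail e
      rw [he] at this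
      rw [if_neg (by omega)]
    rcases Nat.lt_or_eq_of_le hv with hv | hv
    · have h := hP v (by omega)
      have hne : G.level v ≠ n + 1 := by omega
      refine ⟨?_, ?_, fun e he => ?_⟩
      · simpa only [if_neg hne] using h.monic
      · simpa only [if_neg hne] using h.symbol
      · simpa only [if_neg hne, hedge e he] using h.edge e he
    · refine ⟨?_, ?_, fun e he => ?_⟩
      · simpa only [hv, ↓reduceIte] using hQmon v hv
      · simpa only [hv, ↓reduceIte] using hQsym v hv
      · simpa only [if_pos hv, hedge e he] using hQedge v hv e he

/-- Every layered graph in which each vertex of positive level has an outgoing edge admits a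
deformation. -/
theorem exists_lift (S : SymbolAlgebra G F B)
    (hout : ∀ v, 0 < G.level v → ∃ e, G.tail e = v) :
    ∃ P : V → (Module.End F B)[X], ∀ v, S.IsLift P v :=
  (S.exists_lift_le hout G.n).imp fun _ h v => h v (G.level_le v)

end SymbolAlgebra

/-! ### Noncommutative elementary symmetric functions -/

/-- The noncommutative elementary symmetric function `∑ a_{i_1} ⋯ a_{i_k}`, over all
`i_1 < ⋯ < i_k`, of a list. -/
def ncEsymm {R : Type*} [Semiring R] : List R → ℕ → R
  | _, 0 => 1
  | [], _ + 1 => 0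
  | a :: l, k + 1 => ncEsymm l (k + 1) + a * ncEsymm l k

section ncEsymm

@[simp] theorem ncEsymm_zero {R : Type*} [Semiring R] (l : List R) : ncEsymm l 0 = 1 := by
  cases l <;> rfl

@[simp] theorem ncEsymm_nil_succ {R : Type*} [Semiring R] (k : ℕ) :
    ncEsymm ([] : List R) (k + 1) = 0 := rfl

theorem ncEsymm_cons_succ {R : Type*} [Semiring R] (a : R) (l : List R) (k : ℕ) :
    ncEsymm (a :: l) (k + 1) = ncEsymm l (k + 1) + a * ncEsymm l k := rfl

theorem ncEsymm_of_length_lt {R : Type*} [Semiring R] (l : List R) {k : ℕ} (h : l.length < k) :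
    ncEsymm l k = 0 := by
  induction l generalizing k with
  | nil =>
    obtain ⟨k, rfl⟩ := Nat.exists_eq_succ_of_ne_zero (by omega : k ≠ 0)
    rfl
  | cons a l ih =>
    simp only [List.length_cons] at h
    obtain ⟨k, rfl⟩ := Nat.exists_eq_succ_of_ne_zero (by omega : k ≠ 0)
    rw [Nat.succ_eq_add_one, ncEsymm_cons_succ, ih (by omega), ih (by omega), mul_zero, add_zero]

theorem map_ncEsymm {R R' : Type*} [Semiring R] [Semiring R'] (f : R →+* R') (l : List R)
    (k : ℕ) : f (ncEsymm l k) = ncEsymm (l.map f) k := by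
  induction l generalizing k with
  | nil => cases k <;> simp
  | cons a l ih => cases k <;> simp [ncEsymm_cons_succ, ih]

theorem coeff_prod_one_sub_X_mul_C {R : Type*} [Ring R] (l : List R) (k : ℕ) :
    (l.map fun a => (1 - X * C a : R[X])).prod.coeff k = (-1) ^ k * ncEsymm l k := by
  induction l generalizing k with
  | nil => cases k <;> simp [coeff_one]
  | cons a l ih =>
    rw [List.map_cons, List.prod_cons, sub_mul, one_mul, mul_assoc, coeff_sub]
    cases k with
    | zero => rw [mul_coeff_zero X, coeff_X_zero, zero_mul, sub_zero, ih]; simp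
    | succ k =>
      rw [coeff_X_mul, coeff_C_mul, ih, ih, ncEsymm_cons_succ, mul_add, sub_eq_add_neg]
      congr 1
      rw [← mul_assoc, ← mul_assoc, ((Commute.neg_one_right a).pow_right k).eq, pow_succ]
      simp

/-- The polynomial `(X + a_1) ⋯ (X + a_m)` has degree at most `m`, and the coefficient of
`X ^ (m - k)` is the `k`-th elementary symmetric function. -/
theorem coeff_prod_X_add_C {R : Type*} [Semiring R] (l : List R) :
    (∀ i, l.length < i → (l.map fun a => (X + C a : R[X])).prod.coeff i = 0) ∧
      ∀ i k, i + k = l.length → (l.map fun a => (X + C a : R[X])).prod.coeff i = ncEsymm l k := by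
  induction l with
  | nil =>
    refine ⟨fun i hi => ?_, fun i k hik => ?_⟩
    · have : i ≠ 0 := by simp at hi; omega
      simp [coeff_one, this]
    · have : i = 0 ∧ k = 0 := by simp at hik; omega
      simp [this.1, this.2]
  | cons a l ih =>
    obtain ⟨ih0, ih⟩ := ih
    simp only [List.map_cons, List.prod_cons, List.length_cons, add_mul, coeff_add, coeff_C_mul]
    refine ⟨fun i hi => ?_, fun i k hik => ?_⟩
    · obtain ⟨i, rfl⟩ := Nat.exists_eq_succ_of_ne_zero (by omega : i ≠ 0)
      rw [coeff_X_mul, ih0 i (by omega), ih0 (i + 1) (by omega), mul_zero, add_zero]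
    · cases i with
      | zero =>
        obtain rfl : k = l.length + 1 := by omega
        rw [ncEsymm_cons_succ, ncEsymm_of_length_lt l (Nat.lt_succ_self _),
          ih 0 l.length (by omega)]
        simp
      | succ i =>
        rw [coeff_X_mul]
        cases k with
        | zero => rw [ih i 0 (by omega), ih0 (i + 1) (by omega)]; simp
        | succ k => rw [ih i (k + 1) (by omega), ih (i + 1) k (by omega), ncEsymm_cons_succ]

end ncEsymm

/-! ### Algebras given by generators and relations -/

theorem TwoSidedIdeal.exists_lift_span {F A A' : Type*} [Field F] [Ring A] [Algebra F A]
    [Semiring A'] [Algebra F A'] (s : Set A) (f : A →ₐ[F] A') (hf : ∀ x ∈ s, f x = 0) :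
    ∃ g : (TwoSidedIdeal.span s).ringCon.Quotient →ₐ[F] A',
      ∀ x, g ((TwoSidedIdeal.span s).ringCon.mkₐ (α := F) x) = f x := by
  let I : TwoSidedIdeal A := ⟨RingCon.ker f.toRingHom⟩
  have hle : TwoSidedIdeal.span s ≤ I := TwoSidedIdeal.span_le.2 fun x hx =>
    (TwoSidedIdeal.mem_iff I x).2 ((hf x hx).trans (map_zero f).symm)
  exact ⟨(TwoSidedIdeal.span s).ringCon.liftₐ f fun a b hab =>
    (TwoSidedIdeal.rel_iff I a b).2 (hle ((TwoSidedIdeal.rel_iff _ a b).1 hab)), fun x => rfl⟩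

theorem TwoSidedIdeal.mkₐ_eq_of_sub_mem {F A : Type*} [Field F] [Ring A] [Algebra F A]
    {s : Set A} {a b : A} (h : a - b ∈ s) :
    (TwoSidedIdeal.span s).ringCon.mkₐ (α := F) a = (TwoSidedIdeal.span s).ringCon.mkₐ (α := F) b :=
  (RingCon.eq _).2 ((TwoSidedIdeal.rel_iff _ _ _).2 (TwoSidedIdeal.subset_span h))

namespace TensorOn

variable {F : Type*} [Field F] {X : Type*} {A : Type*} [Semiring A] [Algebra F A]

/-- The algebra map `T(X) → A` with prescribed values on `X`. -/
noncomputable def lift (F : Type*) [Field F] {X A : Type*} [Semiring A] [Algebra F A] (f : X → A) :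
    TensorOn F X →ₐ[F] A :=
  TensorAlgebra.lift F (Finsupp.linearCombination F f)

@[simp] theorem lift_gen (f : X → A) (x : X) : lift F f (gen F x) = f x := by
  simp [lift, gen]

theorem lift_word (f : X → A) (l : List X) : lift F f (word F l) = (l.map f).prod := by
  rw [word, map_list_prod, List.map_map]
  congr 2
  ext x
  simp

@[simp] theorem word_nil : word F ([] : List X) = 1 := rfl

theorem word_cons (x : X) (l : List X) : word F (x :: l) = gen F x * word F l := by
  simp [word]

theorem hom_ext {f g : TensorOn F X →ₐ[F] A} (h : ∀ x, f (gen F x) = g (gen F x)) : f = g := by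
  refine TensorAlgebra.hom_ext (Finsupp.lhom_ext' fun x => LinearMap.ext_ring ?_)
  exact h x

theorem span_word : Submodule.span F (Set.range (word F : List X → TensorOn F X)) = ⊤ := by
  rw [Submodule.eq_top_iff']
  intro a
  induction a using TensorAlgebra.induction with
  | algebraMap r =>
    rw [Algebra.algebraMap_eq_smul_one]
    exact Submodule.smul_mem _ _ (Submodule.subset_span ⟨[], rfl⟩)
  | ι m =>
    induction m using Finsupp.induction_linear with
    | zero => rw [map_zero]; exact zero_mem _
    | add f g hf hg => rw [map_add]; exact add_mem hf hg
    | single x c =>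
      rw [← mul_one c, ← smul_eq_mul, ← Finsupp.smul_single, map_smul]
      exact Submodule.smul_mem _ _ (Submodule.subset_span ⟨[x], by simp [word, gen]⟩)
  | mul a b ha hb =>
    have h := Submodule.mul_mem_mul ha hb
    rw [Submodule.span_mul_span] at h
    refine Submodule.span_mono ?_ h
    rintro _ ⟨_, ⟨l, rfl⟩, _, ⟨m, rfl⟩, rfl⟩
    exact ⟨l ++ m, by simp [word]⟩
  | add a b ha hb => exact add_mem ha hb

end TensorOn

namespace LayeredGraph

variable {V E : Type*} {G : LayeredGraph V E}

theorem IsPath.level_eq {v w : V} {p : List E} (h : G.IsPath v p w) :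
    G.level v = G.level w + p.length := by
  induction p generalizing v with
  | nil => rw [show v = w from h]; rfl
  | cons e p ih =>
    obtain ⟨rfl, h⟩ := h
    rw [G.level_tail, ih h, List.length_cons]
    omega

theorem pathCoeff_eq (F : Type*) [Field F] (p : List E) (k : ℕ) :
    pathCoeff F p k = (-1) ^ k * ncEsymm (p.map (TensorOn.gen F)) k := by
  rw [pathCoeff, ← coeff_prod_one_sub_X_mul_C, List.map_map]
  rfl

end LayeredGraph

/-! ### The action of the algebra of the graph -/

namespace SymbolAlgebra

variable {V E : Type*} {G : LayeredGraph V E} {F B : Type*} [Field F] [Ring B] [Algebra F B]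
  {P : V → (Module.End F B)[X]}

/-- The algebra `A(Γ)` acts on `B` in such a way that each edge acts, up to terms of lower degree,
as the multiplication by its tail. -/
theorem exists_action (S : SymbolAlgebra G F B)
    (hout : ∀ v, 0 < G.level v → ∃ e, G.tail e = v) :
    ∃ ρ : G.Alg F →ₐ[F] Module.End F B, ∀ (e : E) (j : ℤ), ∀ y ∈ S.fil j,
      ρ (G.toAlg F (TensorOn.gen F e)) y - S.x (G.tail e) * y ∈
        S.fil (j + G.edgeDegree e - 1) := by
  obtain ⟨P, hP⟩ := S.exists_lift hout
  choose r hr using fun e => (hP (G.tail e)).edge e rfl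
  have hpath : ∀ (p : List E) (v w : V), G.IsPath v p w →
      P v = ((p.map r).map fun a => X + C a).prod * P w := by
    intro p
    induction p with
    | nil => rintro v w rfl; simp
    | cons e p ih =>
      rintro v w ⟨rfl, h⟩
      rw [hr e, ih _ _ h]
      simp [mul_assoc]
  obtain ⟨ρ, hρ⟩ : ∃ ρ : G.Alg F →ₐ[F] Module.End F B,
      ∀ x, ρ (G.toAlg F x) = TensorOn.lift F r x :=
    TwoSidedIdeal.exists_lift_span (G.relators F) (TensorOn.lift F r) (by
    rintro _ ⟨v, w, p₁, p₂, k, h₁, h₂, _, hk, rfl⟩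
    have hlen : p₁.length = p₂.length := by
      have := h₁.level_eq
      have := h₂.level_eq
      omega
    have hmon : (P w).Monic := monic_of_natDegree_le_of_coeff_eq_one _ (hP w).monic.1 (hP w).monic.2
    have heq := hmon.isRegular.right ((hpath p₁ v w h₁).symm.trans (hpath p₂ v w h₂))
    have hsym : ∀ p : List E, TensorOn.lift F r (LayeredGraph.pathCoeff F p k) =
        (-1) ^ k * ncEsymm (p.map r) k := by
      intro p
      rw [LayeredGraph.pathCoeff_eq, map_mul, map_pow, map_neg, map_one]
      congr 1
      refine (map_ncEsymm (TensorOn.lift F r).toRingHom _ k).trans ?_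
      rw [List.map_map]
      congr 2
      ext1 e
      exact TensorOn.lift_gen r e
    rw [map_sub, hsym, hsym,
      ← (coeff_prod_X_add_C (p₁.map r)).2 (p₁.length - k) k (by simp; omega),
      ← (coeff_prod_X_add_C (p₂.map r)).2 (p₁.length - k) k (by simp; omega), heq, sub_self])
  refine ⟨ρ, fun e j y hy => ?_⟩
  rw [show ρ (G.toAlg F (TensorOn.gen F e)) = r e from (hρ _).trans (TensorOn.lift_gen r e)]
  obtain ⟨n, hn⟩ : ∃ n, G.level (G.head e) = n := ⟨_, rfl⟩
  have htail : G.level (G.tail e) = n + 1 := by rw [G.level_tail, hn]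
  have hsymb := (hP (G.tail e)).symbol n (by omega) j y hy
  have hcoeff : (P (G.tail e)).coeff n = (X * P (G.head e)).coeff n + r e := by
    have h1 : (P (G.head e)).coeff n = 1 := hn ▸ (hP (G.head e)).monic.2
    rw [hr e, add_mul, coeff_add, coeff_C_mul, h1, mul_one]
  have hlow : (X * P (G.head e)).coeff n y ∈ S.fil (j + G.edgeDegree e - 1) := by
    cases n with
    | zero => simp
    | succ n =>
      rw [coeff_X_mul]
      refine S.fil_mono ?_ ((hP (G.head e)).coeff_mem (by omega) hy)
      rw [hn, LayeredGraph.edgeDegree, htail, tri_succ]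
      push_cast
      linarith
  have hβ : S.β (G.tail e) n = S.x (G.tail e) := by
    have := S.β_self (G.head e)
    rw [S.β_edge e n hn.ge, ← hn, this, mul_one]
  rw [hcoeff, hβ, LinearMap.add_apply, htail, tri_succ] at hsymb
  have := sub_mem (S.fil_mono (b := j + G.edgeDegree e - 1) ?_ hsymb) hlow
  · convert this using 1
    abel
  · rw [LayeredGraph.edgeDegree, htail]
    push_cast
    linarith

end SymbolAlgebra

/-! ### The grading of `T(V⁺) / R_gr` -/

namespace LayeredGraph

variable {V E : Type*} (G : LayeredGraph V E) (F : Type*) [Field F]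

/-- The class in `T(V⁺) / R_gr` of a vertex. -/
noncomputable def vertexClass (v : V) : G.GrQuotient F := G.toGrQuotient F (G.vertexGen F v)

variable {G}

theorem toGrQuotient_surjective : Function.Surjective (G.toGrQuotient F) :=
  RingCon.mkₐ_surjective _

theorem vertexGen_of_pos {v : V} (h : 0 < G.level v) :
    G.vertexGen F v = TensorOn.gen F (⟨v, h⟩ : G.VPlus) := dif_pos h

theorem vertexGen_of_level_eq_zero {v : V} (h : G.level v = 0) : G.vertexGen F v = 0 :=
  dif_neg (by omega)

@[simp] theorem vertexWord_zero (v : V) (p : List E) : G.vertexWord F v p 0 = 1 := by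
  simp [vertexWord]

@[simp] theorem vertexWord_nil_succ (v : V) (k : ℕ) :
    G.vertexWord F v [] (k + 1) = G.vertexGen F v := by
  simp [vertexWord]

theorem vertexWord_cons_succ (v : V) (e : E) (p : List E) (k : ℕ) :
    G.vertexWord F v (e :: p) (k + 1) = G.vertexGen F v * G.vertexWord F (G.head e) p k := by
  simp [vertexWord]

theorem vertexWord_one (v : V) (p : List E) : G.vertexWord F v p 1 = G.vertexGen F v := by
  simp [vertexWord]

/-- The defining relations of `T(V⁺) / R_gr`, without the restrictions on short words, for
which they are trivial. -/
theorem toGrQuotient_vertexWord_eq {v w₁ w₂ : V} {p₁ p₂ : List E} {k : ℕ} (h₁ : G.IsPath v p₁ w₁)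
    (h₂ : G.IsPath v p₂ w₂) (hk₁ : k ≤ p₁.length) (hk₂ : k ≤ p₂.length + 1) :
    G.toGrQuotient F (G.vertexWord F v p₁ k) = G.toGrQuotient F (G.vertexWord F v p₂ k) := by
  rcases k with _ | _ | k
  · simp
  · simp only [zero_add, vertexWord_one]
  · exact TwoSidedIdeal.mkₐ_eq_of_sub_mem
      ⟨v, w₁, w₂, p₁, p₂, k + 2, h₁, h₂, by omega, hk₁, hk₂, rfl⟩

theorem exists_isPath_length_eq (hout : ∀ v, 0 < G.level v → ∃ e, G.tail e = v) (v : V) :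
    ∃ p w, G.IsPath v p w ∧ p.length = G.level v := by
  obtain ⟨n, hn⟩ : ∃ n, G.level v = n := ⟨_, rfl⟩
  induction n generalizing v with
  | zero => exact ⟨[], v, rfl, by simp [hn]⟩
  | succ n ih =>
    obtain ⟨e, rfl⟩ := hout v (by omega)
    have := G.level_tail e
    obtain ⟨p, w, hp, hl⟩ := ih (G.head e) (by omega)
    exact ⟨e :: p, w, ⟨rfl, hp⟩, by rw [List.length_cons]; omega⟩

/-- The word of the first `k` vertices of a path from `v` is homogeneous, of a degree that depends
only on `|v|` and `k`. -/
theorem lift_vertexWord {A : Type*} [Ring A] [Algebra F A] (f : V → A) {v w : V}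
    {p : List E} (hp : G.IsPath v p w) {k : ℕ} (hk : k ≤ p.length + 1) :
    TensorOn.lift F (fun v : G.VPlus => AddMonoidAlgebra.single (G.level v.1 : ℤ) (f v.1))
      (G.vertexWord F v p k) =
    AddMonoidAlgebra.single (tri (G.level v) - tri (G.level v - k))
      (TensorOn.lift F (fun v : G.VPlus => f v.1) (G.vertexWord F v p k)) := by
  have hgen : ∀ v, TensorOn.lift F (fun v : G.VPlus => AddMonoidAlgebra.single (G.level v.1 : ℤ)
      (f v.1)) (G.vertexGen F v) = AddMonoidAlgebra.single (G.level v : ℤ)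
        (TensorOn.lift F (fun v : G.VPlus => f v.1) (G.vertexGen F v)) := by
    intro v
    rcases Nat.eq_zero_or_pos (G.level v) with h | h
    · rw [vertexGen_of_level_eq_zero F h, map_zero, map_zero, AddMonoidAlgebra.single_zero]
    · rw [vertexGen_of_pos F h, TensorOn.lift_gen, TensorOn.lift_gen]
  induction p generalizing v k with
  | nil =>
    cases k with
    | zero =>
      rw [vertexWord_zero, map_one, map_one, Nat.sub_zero, sub_self, AddMonoidAlgebra.one_def]
    | succ k =>
      obtain rfl : k = 0 := by simpa using hk
      rw [vertexWord_nil_succ, hgen]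
      congr 1
      cases h : G.level v with
      | zero => simp
      | succ n => rw [zero_add, Nat.add_sub_cancel, tri_succ]; push_cast; ring
  | cons e p ih =>
    obtain ⟨rfl, hp⟩ := hp
    cases k with
    | zero =>
      rw [vertexWord_zero, map_one, map_one, Nat.sub_zero, sub_self, AddMonoidAlgebra.one_def]
    | succ k =>
      rw [vertexWord_cons_succ, map_mul, map_mul, ih hp (by simpa using hk), hgen,
        AddMonoidAlgebra.single_mul_single]
      congr 1
      rw [G.level_tail, Nat.add_sub_add_right, tri_succ]
      push_cast
      ring

theorem toGrQuotient_eq_lift :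
    G.toGrQuotient F = TensorOn.lift F fun v : G.VPlus => G.vertexClass F v.1 := by
  refine TensorOn.hom_ext fun v => ?_
  rw [TensorOn.lift_gen, vertexClass, vertexGen_of_pos F v.2]

/-- The ideal `R_gr` is homogeneous: the degrees of vertices define a coaction of the polynomial
ring on `T(V⁺) / R_gr`, here with values in Laurent polynomials. -/
theorem exists_coaction : ∃ δ : G.GrQuotient F →ₐ[F] AddMonoidAlgebra (G.GrQuotient F) ℤ,
    ∀ a, δ (G.toGrQuotient F a) = TensorOn.lift F (fun v : G.VPlus =>
      AddMonoidAlgebra.single (G.level v.1 : ℤ) (G.vertexClass F v.1)) a := by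
  refine TwoSidedIdeal.exists_lift_span (G.grRelators F) _ ?_
  rintro _ ⟨v, w₁, w₂, p₁, p₂, k, h₁, h₂, _, hk₁, hk₂, rfl⟩
  rw [map_sub, lift_vertexWord F _ h₁ (by omega), lift_vertexWord F _ h₂ hk₂,
    ← toGrQuotient_eq_lift, toGrQuotient_vertexWord_eq F h₁ h₂ hk₁ hk₂, sub_self]

/-- The algebra map `T(V⁺) / R_gr → (T(V⁺) / R_gr)[t, t⁻¹]` with `v ↦ v t ^ |v|`. -/
noncomputable def coaction (G : LayeredGraph V E) (F : Type*) [Field F] :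
    G.GrQuotient F →ₐ[F] AddMonoidAlgebra (G.GrQuotient F) ℤ :=
  (exists_coaction (G := G) F).choose

theorem coaction_toGrQuotient (a : TensorOn F G.VPlus) :
    G.coaction F (G.toGrQuotient F a) = TensorOn.lift F (fun v : G.VPlus =>
      AddMonoidAlgebra.single (G.level v.1 : ℤ) (G.vertexClass F v.1)) a :=
  (exists_coaction F).choose_spec a

theorem coaction_vertexWord {v w : V} {p : List E} (hp : G.IsPath v p w) {k : ℕ}
    (hk : k ≤ p.length + 1) : G.coaction F (G.toGrQuotient F (G.vertexWord F v p k)) =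
      AddMonoidAlgebra.single (tri (G.level v) - tri (G.level v - k))
        (G.toGrQuotient F (G.vertexWord F v p k)) := by
  rw [coaction_toGrQuotient, lift_vertexWord F _ hp hk, ← toGrQuotient_eq_lift]

theorem coaction_vertexClass (v : V) : G.coaction F (G.vertexClass F v) =
    AddMonoidAlgebra.single (G.level v : ℤ) (G.vertexClass F v) := by
  rcases Nat.eq_zero_or_pos (G.level v) with h | h
  · rw [vertexClass, vertexGen_of_level_eq_zero F h, map_zero, map_zero,
      AddMonoidAlgebra.single_zero]
  · rw [vertexClass, coaction_toGrQuotient, vertexGen_of_pos F h, TensorOn.lift_gen, vertexClass,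
      vertexGen_of_pos F h]

theorem coaction_word (l : List G.VPlus) : G.coaction F (G.toGrQuotient F (TensorOn.word F l)) =
    AddMonoidAlgebra.single ((l.map G.vertexDegree).sum : ℤ)
      (G.toGrQuotient F (TensorOn.word F l)) := by
  induction l with
  | nil => rw [TensorOn.word_nil, map_one, map_one, AddMonoidAlgebra.one_def]; rfl
  | cons v l ih =>
    have h := coaction_vertexClass (G := G) F v.1
    rw [vertexClass, vertexGen_of_pos F v.2] at h
    rw [TensorOn.word_cons, map_mul, map_mul, ih, h, AddMonoidAlgebra.single_mul_single,
      List.map_cons, List.sum_cons]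
    push_cast
    rfl

/-- The component of degree `i` of an element of `T(V⁺) / R_gr`. -/
noncomputable def grPart (G : LayeredGraph V E) (F : Type*) [Field F] (i : ℤ) :
    G.GrQuotient F →ₗ[F] G.GrQuotient F where
  toFun b := (G.coaction F b).coeff i
  map_add' a b := by simp
  map_smul' c b := by simp

theorem grPart_word (i : ℤ) (l : List G.VPlus) :
    G.grPart F i (G.toGrQuotient F (TensorOn.word F l)) =
      if ((l.map G.vertexDegree).sum : ℤ) = i then G.toGrQuotient F (TensorOn.word F l) else 0 := by
  change (G.coaction F _).coeff i = _
  rw [coaction_word, AddMonoidAlgebra.coeff_single, Finsupp.single_apply]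

/-- Linear maps on `T(V⁺) / R_gr` are determined by their values on words. -/
theorem grQuotient_ext {M : Type*} [AddCommGroup M] [Module F M] {f g : G.GrQuotient F →ₗ[F] M}
    (h : ∀ l : List G.VPlus, f (G.toGrQuotient F (TensorOn.word F l)) =
      g (G.toGrQuotient F (TensorOn.word F l))) : f = g := by
  have h1 : f.comp (G.toGrQuotient F).toLinearMap = g.comp (G.toGrQuotient F).toLinearMap :=
    LinearMap.ext_on TensorOn.span_word (by rintro _ ⟨l, rfl⟩; exact h l)
  ext b
  obtain ⟨a, rfl⟩ := toGrQuotient_surjective F b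
  exact LinearMap.congr_fun h1 a

theorem grPart_of_neg {i : ℤ} (hi : i < 0) : G.grPart F i = 0 := by
  refine grQuotient_ext F fun l => ?_
  rw [grPart_word, if_neg, LinearMap.zero_apply]
  have : (0 : ℤ) ≤ ((l.map G.vertexDegree).sum : ℤ) := Int.natCast_nonneg _
  omega

theorem grPart_grPart (i j : ℤ) (b : G.GrQuotient F) :
    G.grPart F i (G.grPart F j b) = if i = j then G.grPart F j b else 0 := by
  have h : (G.grPart F i).comp (G.grPart F j) = if i = j then G.grPart F j else 0 := by
    refine grQuotient_ext F fun l => ?_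
    rw [LinearMap.comp_apply, grPart_word]
    by_cases h1 : ((l.map G.vertexDegree).sum : ℤ) = j
    · rw [if_pos h1, grPart_word, h1]
      by_cases h2 : i = j
      · rw [if_pos h2, if_pos h2.symm, grPart_word, if_pos h1]
      · rw [if_neg h2, if_neg (Ne.symm h2), LinearMap.zero_apply]
    · rw [if_neg h1, map_zero]
      split_ifs
      · rw [grPart_word, if_neg h1]
      · rfl
  rw [← LinearMap.comp_apply, h]
  split_ifs <;> rfl

/-- An element of `T(V⁺) / R_gr` is the sum of its homogeneous components. -/
theorem sum_grPart (b : G.GrQuotient F) :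
    ∑ i ∈ (G.coaction F b).coeff.support, G.grPart F i b = b := by
  let total : G.GrQuotient F →ₗ[F] G.GrQuotient F :=
    { toFun := fun b => (G.coaction F b).coeff.sum fun _ x => x
      map_add' := fun a b => by
        rw [map_add, AddMonoidAlgebra.coeff_add]
        exact Finsupp.sum_add_index' (fun _ => rfl) (fun _ _ _ => rfl)
      map_smul' := fun c b => by
        rw [map_smul, AddMonoidAlgebra.coeff_smul, Finsupp.sum_smul_index' (fun _ => rfl)]
        exact Finsupp.smul_sum.symm }
  have h : total = LinearMap.id := by
    refine grQuotient_ext F fun l => ?_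
    change ((G.coaction F _).coeff.sum fun _ x => x) = _
    rw [coaction_word, AddMonoidAlgebra.coeff_single]
    exact Finsupp.sum_single_index (h := fun _ x => x) rfl
  exact LinearMap.congr_fun h b

theorem grPart_mul {n : ℤ} {a : G.GrQuotient F}
    (ha : G.coaction F a = AddMonoidAlgebra.single n a) (i : ℤ) (b : G.GrQuotient F) :
    G.grPart F i (a * b) = a * G.grPart F (i - n) b := by
  change (G.coaction F _).coeff i = a * (G.coaction F b).coeff (i - n)
  rw [map_mul, ha, AddMonoidAlgebra.coeff_single_mul_apply, neg_add_eq_sub]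

/-- The filtration of `T(V⁺) / R_gr` by degree. -/
noncomputable def grFil (G : LayeredGraph V E) (F : Type*) [Field F] (j : ℤ) :
    Submodule F (G.GrQuotient F) :=
  ⨅ i : ℤ, ⨅ _ : j < i, LinearMap.ker (G.grPart F i)

variable {F}

theorem mem_grFil {j : ℤ} {b : G.GrQuotient F} :
    b ∈ G.grFil F j ↔ ∀ i, j < i → G.grPart F i b = 0 := by
  simp [grFil]

theorem grFil_mono : Monotone (G.grFil F) := fun _ _ h _ hb =>
  mem_grFil.2 fun i hi => mem_grFil.1 hb i (h.trans_lt hi)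

theorem exists_mem_grFil (b : G.GrQuotient F) : ∃ j, b ∈ G.grFil F j := by
  obtain ⟨j, hj⟩ := (G.coaction F b).coeff.support.bddAbove
  refine ⟨j, mem_grFil.2 fun i hi => ?_⟩
  by_contra hne
  exact absurd (hj (Finset.mem_coe.2 (Finsupp.mem_support_iff.2 hne))) (not_le.2 hi)

theorem eq_zero_of_mem_grFil {j : ℤ} {b : G.GrQuotient F} (hj : j < 0) (hb : b ∈ G.grFil F j) :
    b = 0 := by
  rw [← sum_grPart F b]
  refine Finset.sum_eq_zero fun i _ => ?_
  rcases lt_or_ge i 0 with hi | hi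
  · rw [grPart_of_neg F hi, LinearMap.zero_apply]
  · exact mem_grFil.1 hb i (by omega)

theorem mul_mem_grFil {n j : ℤ} {a b : G.GrQuotient F}
    (ha : G.coaction F a = AddMonoidAlgebra.single n a) (hb : b ∈ G.grFil F j) :
    a * b ∈ G.grFil F (j + n) :=
  mem_grFil.2 fun i hi => by
    rw [grPart_mul F ha, mem_grFil.1 hb _ (by omega), mul_zero]

theorem grPart_mem_grFil (j : ℤ) (b : G.GrQuotient F) : G.grPart F j b ∈ G.grFil F j :=
  mem_grFil.2 fun i hi => by rw [grPart_grPart, if_neg hi.ne']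

theorem sub_grPart_mem_grFil {j : ℤ} {b : G.GrQuotient F} (hb : b ∈ G.grFil F j) :
    b - G.grPart F j b ∈ G.grFil F (j - 1) :=
  mem_grFil.2 fun i hi => by
    rw [map_sub, grPart_grPart]
    rcases eq_or_ne i j with rfl | hij
    · simp
    · rw [if_neg hij, mem_grFil.1 hb i (by omega), sub_zero]

/-! ### Syzygies in `T(V⁺) / R_gr` -/

variable (F) in
/-- The product in `T(V⁺) / R_gr` of the vertices on levels `|v|, …, i + 1` of the path `p v`
that starts at `v`. -/
noncomputable def pathClass (p : V → List E) (v : V) (i : ℕ) : G.GrQuotient F :=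
  G.toGrQuotient F (G.vertexWord F v (p v) (G.level v - i))

variable {p : V → List E}

/-- The class of the first `k` vertices of a path depends only on where the path starts. -/
theorem pathClass_eq (hp : ∀ v, ∃ w, G.IsPath v (p v) w ∧ (p v).length = G.level v) {v w : V}
    {q : List E} (hq : G.IsPath v q w) {k : ℕ} (hk : k ≤ G.level v) (hkq : k ≤ q.length + 1) :
    G.toGrQuotient F (G.vertexWord F v q k) = G.pathClass F p v (G.level v - k) := by
  obtain ⟨w', hw, hl⟩ := hp v
  rw [pathClass, Nat.sub_sub_self hk]
  exact (toGrQuotient_vertexWord_eq F hw hq (by omega) hkq).symm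

theorem pathClass_self (v : V) : G.pathClass F p v (G.level v) = 1 := by
  rw [pathClass, Nat.sub_self, vertexWord_zero, map_one]

theorem pathClass_edge (hp : ∀ v, ∃ w, G.IsPath v (p v) w ∧ (p v).length = G.level v) (e : E)
    {i : ℕ} (hi : i ≤ G.level (G.head e)) : G.pathClass F p (G.tail e) i =
      G.vertexClass F (G.tail e) * G.pathClass F p (G.head e) i := by
  obtain ⟨w, hw, hl⟩ := hp (G.head e)
  have hlev := G.level_tail e
  have h := pathClass_eq (F := F) hp (q := e :: p (G.head e)) ⟨rfl, hw⟩
    (k := G.level (G.head e) - i + 1) (by omega) (by rw [List.length_cons]; omega)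
  rw [vertexWord_cons_succ, map_mul,
    show G.level (G.tail e) - (G.level (G.head e) - i + 1) = i by omega] at h
  exact h.symm

theorem coaction_pathClass (hp : ∀ v, ∃ w, G.IsPath v (p v) w ∧ (p v).length = G.level v) {v : V}
    {i : ℕ} (hi : i ≤ G.level v) : G.coaction F (G.pathClass F p v i) =
      AddMonoidAlgebra.single (tri (G.level v) - tri i) (G.pathClass F p v i) := by
  obtain ⟨w, hw, hl⟩ := hp v
  have := coaction_vertexWord F hw (k := G.level v - i) (by omega)
  rwa [Nat.sub_sub_self hi] at this

/-- The right ideal of `T(V⁺) / R_gr` that is generated by the differences of the classes of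
paths, with the same last level, that start at children of `v`. -/
noncomputable def syzygyIdeal (G : LayeredGraph V E) (F : Type*) [Field F] (p : V → List E)
    (v : V) : Submodule F (G.GrQuotient F) :=
  Submodule.span F {u | ∃ e e' i t, G.tail e = v ∧ G.tail e' = v ∧ i < G.level (G.head e) ∧
    u = (G.pathClass F p (G.head e) i - G.pathClass F p (G.head e') i) * t}

open Classical in
/-- The operator `(b, c) ↦ (v b, b)` on `B × ∏ v, B / J_v`, where `B = T(V⁺) / R_gr`, `J_v` is the
right ideal `syzygyIdeal`, and the second entry is in the factor with index `v`. -/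
noncomputable def syzygyOp (G : LayeredGraph V E) (F : Type*) [Field F] (p : V → List E) (v : V) :
    Module.End F (G.GrQuotient F × (∀ v : V, G.GrQuotient F ⧸ G.syzygyIdeal F p v)) :=
  LinearMap.prod ((LinearMap.mulLeft F (G.vertexClass F v)).comp (LinearMap.fst F _ _))
    ((LinearMap.single F _ v).comp ((G.syzygyIdeal F p v).mkQ.comp (LinearMap.fst F _ _)))

open Classical in
theorem syzygyOp_apply (v : V) (m : G.GrQuotient F × (∀ v : V, G.GrQuotient F ⧸
    G.syzygyIdeal F p v)) : G.syzygyOp F p v m =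
      (G.vertexClass F v * m.1, Pi.single v ((G.syzygyIdeal F p v).mkQ m.1)) := rfl

theorem lift_syzygyOp_fst (a : TensorOn F G.VPlus) (m : G.GrQuotient F × (∀ v : V,
    G.GrQuotient F ⧸ G.syzygyIdeal F p v)) :
    (TensorOn.lift F (fun v : G.VPlus => G.syzygyOp F p v.1) a m).1 =
      G.toGrQuotient F a * m.1 := by
  let f : TensorOn F G.VPlus →ₗ[F] G.GrQuotient F :=
    (LinearMap.fst F _ _).comp ((LinearMap.applyₗ m).comp
      (TensorOn.lift F (fun v : G.VPlus => G.syzygyOp F p v.1)).toLinearMap)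
  let g : TensorOn F G.VPlus →ₗ[F] G.GrQuotient F :=
    (LinearMap.mulRight F m.1).comp (G.toGrQuotient F).toLinearMap
  suffices h : f = g from LinearMap.congr_fun h a
  refine LinearMap.ext_on TensorOn.span_word ?_
  rintro _ ⟨l, rfl⟩
  change (TensorOn.lift F (fun v : G.VPlus => G.syzygyOp F p v.1) (TensorOn.word F l) m).1 =
    G.toGrQuotient F (TensorOn.word F l) * m.1
  induction l with
  | nil => rw [TensorOn.word_nil, map_one, map_one, one_mul, Module.End.one_apply]
  | cons v l ih =>
    rw [TensorOn.word_cons, map_mul, map_mul, TensorOn.lift_gen, Module.End.mul_apply,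
      syzygyOp_apply, ih, vertexClass, vertexGen_of_pos F v.2, mul_assoc]

/-- The operators `syzygyOp` make `B × ∏ v, B / J_v` a module over `B = T(V⁺) / R_gr`. -/
theorem exists_syzygyOp_action (hp : ∀ v, ∃ w, G.IsPath v (p v) w ∧ (p v).length = G.level v) :
    ∃ ρ : G.GrQuotient F →ₐ[F] Module.End F (G.GrQuotient F × (∀ v : V, G.GrQuotient F ⧸
      G.syzygyIdeal F p v)), ∀ a, ρ (G.toGrQuotient F a) =
        TensorOn.lift F (fun v : G.VPlus => G.syzygyOp F p v.1) a := by
  classical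
  refine TwoSidedIdeal.exists_lift_span (G.grRelators F)
    (TensorOn.lift F fun v : G.VPlus => G.syzygyOp F p v.1) ?_
  rintro _ ⟨v, w₁, w₂, p₁, p₂, k, h₁, h₂, hk, hk₁, hk₂, rfl⟩
  obtain ⟨k, rfl⟩ : ∃ l, k = l + 1 := ⟨k - 1, by omega⟩
  have heq := toGrQuotient_vertexWord_eq F h₁ h₂ hk₁ hk₂
  cases p₁ with
  | nil => simp at hk₁
  | cons e₁ p₁ =>
  cases p₂ with
  | nil => simp at hk₂; omega
  | cons e₂ p₂ =>
  obtain ⟨rfl, h₁⟩ := h₁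
  obtain ⟨he, h₂⟩ := h₂
  simp only [List.length_cons] at hk₁ hk₂
  have hlev₁ := G.level_tail e₁
  have hlev₂ := G.level_tail e₂
  rw [he] at hlev₂
  have hl₁ := h₁.level_eq
  rw [vertexWord_cons_succ, vertexWord_cons_succ] at heq ⊢
  refine LinearMap.ext fun m => ?_
  rw [map_sub, map_mul, map_mul, vertexGen_of_pos F (by omega : 0 < G.level (G.tail e₁)),
    TensorOn.lift_gen, LinearMap.sub_apply, Module.End.mul_apply, Module.End.mul_apply,
    syzygyOp_apply, syzygyOp_apply, lift_syzygyOp_fst, lift_syzygyOp_fst, LinearMap.zero_apply,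
    Prod.mk_sub_mk, ← Pi.single_sub, ← map_sub, ← mul_assoc, ← mul_assoc]
  rw [map_mul, map_mul] at heq
  rw [vertexClass, heq, sub_self, Submodule.mkQ_apply, (Submodule.Quotient.mk_eq_zero _).2,
    Pi.single_zero]
  · rfl
  rw [← sub_mul, pathClass_eq hp h₁ (by omega) (by omega),
    pathClass_eq hp h₂ (by omega) (by omega),
    show G.level (G.head e₂) - k = G.level (G.head e₁) - k by omega]
  exact Submodule.subset_span ⟨e₁, e₂, _, m.1, rfl, he, by omega, rfl⟩

/-- All relations between products `v y` with `v` a vertex come from `syzygyIdeal`. -/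
theorem mem_syzygyIdeal_of_sum_eq_zero
    (hp : ∀ v, ∃ w, G.IsPath v (p v) w ∧ (p v).length = G.level v) {s : Finset V}
    (hs : ∀ v ∈ s, 0 < G.level v) {y : V → G.GrQuotient F}
    (hy : ∑ v ∈ s, G.vertexClass F v * y v = 0) {v : V} (hv : v ∈ s) :
    y v ∈ G.syzygyIdeal F p v := by
  classical
  obtain ⟨ρ, hρ⟩ := exists_syzygyOp_action (F := F) hp
  have hterm : ∀ w ∈ s, (ρ (G.vertexClass F w * y w) (1, 0)).2 =
      Pi.single w ((G.syzygyIdeal F p w).mkQ (y w)) := by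
    intro w hw
    obtain ⟨a, ha⟩ := toGrQuotient_surjective F (y w)
    rw [← ha, map_mul, vertexClass, hρ, hρ, vertexGen_of_pos F (hs w hw), TensorOn.lift_gen,
      Module.End.mul_apply, syzygyOp_apply, lift_syzygyOp_fst, mul_one]
  have h : (ρ (∑ w ∈ s, G.vertexClass F w * y w) (1, 0)).2 v = 0 := by
    rw [hy, map_zero]
    rfl
  rw [map_sum, LinearMap.sum_apply, Prod.snd_sum, Finset.sum_congr rfl hterm, Finset.sum_apply,
    Finset.sum_eq_single v (fun w _ hw => Pi.single_eq_of_ne hw.symm _) (fun h => absurd hv h),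
    Pi.single_eq_same] at h
  exact (Submodule.Quotient.mk_eq_zero _).1 h

/-- The filtered form of `mem_syzygyIdeal_of_sum_eq_zero`, obtained by taking homogeneous
components. -/
theorem mem_span_sup_of_sum_mem
    (hp : ∀ v, ∃ w, G.IsPath v (p v) w ∧ (p v).length = G.level v) {n : ℕ} {s : Finset V}
    {y : V → G.GrQuotient F} {D : ℤ} (hs : ∀ v ∈ s, G.level v = n + 1)
    (hy : ∀ v ∈ s, y v ∈ G.grFil F (D + tri n))
    (hsum : ∑ v ∈ s, G.vertexClass F v * y v ∈ G.grFil F (D + tri (n + 1) - 1)) {v : V}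
    (hv : v ∈ s) : y v ∈ Submodule.span F {u | ∃ e e' i, ∃ t ∈ G.grFil F (D + tri i),
      G.tail e = v ∧ G.tail e' = v ∧ i < n ∧
        u = (G.pathClass F p (G.head e) i - G.pathClass F p (G.head e') i) * t} ⊔
      G.grFil F (D + tri n - 1) := by
  have h0 : ∑ w ∈ s, G.vertexClass F w * G.grPart F (D + tri n) (y w) = 0 := by
    rw [← mem_grFil.1 hsum (D + tri (n + 1)) (by omega), map_sum]
    refine Finset.sum_congr rfl fun w hw => ?_
    rw [grPart_mul F (coaction_vertexClass F w), hs w hw, tri_succ]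
    congr 3
    push_cast
    ring
  have h1 := mem_syzygyIdeal_of_sum_eq_zero hp (fun w hw => by rw [hs w hw]; omega) h0 hv
  have h2 : G.syzygyIdeal F p v ≤ (Submodule.span F {u | ∃ e e' i, ∃ t ∈ G.grFil F (D + tri i),
      G.tail e = v ∧ G.tail e' = v ∧ i < n ∧
        u = (G.pathClass F p (G.head e) i - G.pathClass F p (G.head e') i) * t}).comap
          (G.grPart F (D + tri n)) := by
    refine Submodule.span_le.2 ?_
    rintro _ ⟨e, e', i, t, he, he', hi, rfl⟩
    have hl : G.level (G.head e) = n := by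
      have := G.level_tail e
      rw [he, hs v hv] at this
      omega
    have hl' : G.level (G.head e') = n := by
      have := G.level_tail e'
      rw [he', hs v hv] at this
      omega
    have hco : ∀ e, G.level (G.head e) = n → G.grPart F (D + tri n)
        (G.pathClass F p (G.head e) i * t) =
          G.pathClass F p (G.head e) i * G.grPart F (D + tri i) t := by
      intro e hl
      rw [grPart_mul F (coaction_pathClass hp (by omega)), hl]
      congr 3
      ring
    refine Submodule.subset_span ⟨e, e', i, _, grPart_mem_grFil (D + tri i) t, he, he',
      by omega, ?_⟩
    rw [sub_mul, map_sub, hco e hl, hco e' hl', sub_mul]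
  have h3 := h2 h1
  rw [Submodule.mem_comap, grPart_grPart, if_pos rfl] at h3
  rw [← add_sub_cancel (G.grPart F (D + tri n) (y v)) (y v)]
  exact add_mem (Submodule.mem_sup_left h3)
    (Submodule.mem_sup_right (sub_grPart_mem_grFil (hy v hv)))

/-- The algebra `T(V⁺) / R_gr` with its filtration by degree. -/
noncomputable def symbolAlgebra
    (hp : ∀ v, ∃ w, G.IsPath v (p v) w ∧ (p v).length = G.level v) :
    SymbolAlgebra G F (G.GrQuotient F) where
  fil := G.grFil F
  fil_mono := grFil_mono
  exists_mem_fil := exists_mem_grFil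
  eq_zero_of_neg := eq_zero_of_mem_grFil
  x := G.vertexClass F
  β := G.pathClass F p
  β_self := pathClass_self
  β_edge e _ := pathClass_edge hp e
  x_mul_mem := mul_mem_grFil (coaction_vertexClass F _)
  β_mul_mem hi hy := add_sub_assoc _ _ (_ : ℤ) ▸ mul_mem_grFil (coaction_pathClass hp hi) hy
  syzygy _ _ _ _ hs hy hsum _ hv := mem_span_sup_of_sum_mem hp hs hy hsum hv

end LayeredGraph

/-! ### Classes in the associated graded algebra -/

namespace AlgFiltration

variable {F A : Type*} [Field F] [Ring A] [Algebra F A] {fil : AlgFiltration F A}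

theorem grClass_congr {i j : ℕ} (hij : i = j) {x y : A} (hxy : x = y) (hx : x ∈ fil.piece i) :
    fil.grClass x hx = fil.grClass (i := j) y (hij ▸ hxy ▸ hx) := by
  subst hij hxy
  rfl

theorem grClass_one : fil.grClass (i := 0) 1 fil.one_mem = 1 := rfl

theorem grClass_mul {i j : ℕ} {x y : A} (hx : x ∈ fil.piece i) (hy : y ∈ fil.piece j) :
    fil.grClass x hx * fil.grClass y hy = fil.grClass (x * y) (fil.mul_mem hx hy) :=
  DirectSum.of_mul_of (A := fil.Gr) (fil.toGr i ⟨x, hx⟩) (fil.toGr j ⟨y, hy⟩)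

theorem grClass_add {i : ℕ} {x y : A} (hx : x ∈ fil.piece i) (hy : y ∈ fil.piece i) :
    fil.grClass (x + y) (add_mem hx hy) = fil.grClass x hx + fil.grClass y hy := by
  rw [grClass, grClass, grClass, ← map_add, ← map_add]
  rfl

theorem grClass_smul {i : ℕ} (c : F) {x : A} (hx : x ∈ fil.piece i) :
    fil.grClass (c • x) (Submodule.smul_mem _ c hx) = c • fil.grClass x hx := by
  rw [grClass, grClass, ← map_smul, ← map_smul]
  rfl

theorem grClass_zero (i : ℕ) : fil.grClass (i := i) 0 (zero_mem _) = 0 := by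
  rw [grClass, ← map_zero (DirectSum.lof F ℕ fil.Gr i), ← map_zero (fil.toGr i)]
  rfl

theorem grClass_eq_zero_iff {i : ℕ} {x : A} (hx : x ∈ fil.piece i) :
    fil.grClass x hx = 0 ↔ x ∈ fil.lower i := by
  rw [grClass, DirectSum.lof_eq_of, ← map_zero (DirectSum.of fil.Gr i),
    (DirectSum.of_injective i).eq_iff]
  exact Submodule.Quotient.mk_eq_zero (fil.lowerIn i)

theorem piece_le_lower {i j : ℕ} (h : j < i) : fil.piece j ≤ fil.lower i := by
  obtain ⟨i, rfl⟩ := Nat.exists_eq_succ_of_ne_zero (by omega : i ≠ 0)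
  exact fil.mono (by omega)

theorem grClass_eq_of_sub_mem {i : ℕ} {x y : A} (hx : x ∈ fil.piece i) (hy : y ∈ fil.piece i)
    (h : x - y ∈ fil.lower i) : fil.grClass x hx = fil.grClass y hy := by
  rw [grClass, grClass]
  congr 1
  exact (Submodule.Quotient.eq (fil.lowerIn i)).2 h

theorem mem_grComponent {i : ℕ} {z : fil.GrAlgebra} :
    z ∈ fil.grComponent i ↔ ∃ x, ∃ hx : x ∈ fil.piece i, fil.grClass x hx = z := by
  constructor
  · rintro ⟨y, rfl⟩
    obtain ⟨⟨x, hx⟩, rfl⟩ := fil.toGr_surjective i y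
    exact ⟨x, hx, rfl⟩
  · rintro ⟨x, hx, rfl⟩
    exact ⟨_, rfl⟩

end AlgFiltration

namespace LayeredGraph

variable {V E : Type*} {G : LayeredGraph V E} {F : Type*} [Field F]

theorem mem_algFiltration_of_mem {i : ℕ} {a : TensorOn F E}
    (ha : a ∈ (TensorOn.filtration F G.edgeDegree).piece i) :
    G.toAlg F a ∈ (G.algFiltration F).piece i := ⟨a, ha, rfl⟩

theorem word_mem_filtration (l : List E) :
    TensorOn.word F l ∈ (TensorOn.filtration F G.edgeDegree).piece (l.map G.edgeDegree).sum :=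
  Submodule.subset_span ⟨l, le_rfl, rfl⟩

/-- A product of classes of edges is the class of the product. -/
theorem prod_edgeClass (l : List E) : (l.map (G.edgeClass F)).prod =
    (G.algFiltration F).grClass (G.toAlg F (TensorOn.word F l))
      (mem_algFiltration_of_mem (word_mem_filtration l)) := by
  induction l with
  | nil => exact AlgFiltration.grClass_one.symm
  | cons e l ih =>
    rw [List.map_cons, List.prod_cons, ih, edgeClass, AlgFiltration.grClass_mul]
    refine AlgFiltration.grClass_congr rfl ?_ _
    rw [TensorOn.word_cons, map_mul]

/-! ### The relations of `T(V⁺) / R_gr` hold in the associated graded algebra -/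

/-- `n + (n - 1) + ⋯ + (n - k + 1)`. -/
def topSum (n k : ℕ) : ℕ := ∑ i ∈ Finset.range k, (n - i)

theorem topSum_succ_succ (n k : ℕ) : topSum (n + 1) (k + 1) = (n + 1) + topSum n k := by
  rw [topSum, Finset.sum_range_succ', topSum, Nat.sub_zero, add_comm]
  simp

theorem topSum_lt (n k : ℕ) : topSum n (k + 1) < topSum (n + 1) (k + 1) := by
  rw [topSum_succ_succ, topSum, Finset.sum_range_succ, topSum]
  omega

theorem ncEsymm_mem_filtration {v w : V} {q : List E} (hq : G.IsPath v q w) (k : ℕ) :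
    ncEsymm (q.map (TensorOn.gen F)) k ∈
      (TensorOn.filtration F G.edgeDegree).piece (topSum (G.level v) k) := by
  induction q generalizing v k with
  | nil =>
    cases k with
    | zero => rw [ncEsymm_zero]; exact (TensorOn.filtration F G.edgeDegree).one_mem
    | succ k => exact zero_mem _
  | cons e q ih =>
    obtain ⟨rfl, hq⟩ := hq
    cases k with
    | zero => rw [ncEsymm_zero]; exact (TensorOn.filtration F G.edgeDegree).one_mem
    | succ k =>
      rw [List.map_cons, ncEsymm_cons_succ, G.level_tail]
      refine add_mem ((TensorOn.filtration F G.edgeDegree).mono (topSum_lt _ _).le (ih hq _)) ?_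
      have := (TensorOn.filtration F G.edgeDegree).mul_mem
        (TensorOn.gen_mem_filtration F G.edgeDegree e) (ih hq k)
      rwa [edgeDegree, G.level_tail, ← topSum_succ_succ] at this

/-- The class of `(-1) ^ k e(q, k)` for a path `q` from `v`, in the degree of the product of the
first `k` edges of `q`. -/
noncomputable def coeffClass (F : Type*) [Field F] {v w : V} {q : List E} (hq : G.IsPath v q w)
    (k : ℕ) : G.GrAlg F :=
  (G.algFiltration F).grClass (G.toAlg F (ncEsymm (q.map (TensorOn.gen F)) k))
    (mem_algFiltration_of_mem (ncEsymm_mem_filtration hq k))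

@[simp] theorem coeffClass_zero {v w : V} {q : List E} (hq : G.IsPath v q w) :
    coeffClass F hq 0 = 1 :=
  AlgFiltration.grClass_congr rfl (by rw [ncEsymm_zero, map_one]) _

/-- In `(1 - t e) (1 - t e_2) ⋯`, the terms that do not involve the first edge `e` have lower
degree. -/
theorem coeffClass_cons {e : E} {w : V} {q : List E} (hq : G.IsPath (G.head e) q w) (k : ℕ) :
    coeffClass F (show G.IsPath (G.tail e) (e :: q) w from ⟨rfl, hq⟩) (k + 1) =
      G.edgeClass F e * coeffClass F hq k := by
  have hdeg : topSum (G.level (G.tail e)) (k + 1) =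
      G.edgeDegree e + topSum (G.level (G.head e)) k := by
    rw [edgeDegree, G.level_tail, topSum_succ_succ]
  rw [edgeClass, coeffClass, coeffClass, AlgFiltration.grClass_mul,
    AlgFiltration.grClass_congr hdeg rfl]
  refine AlgFiltration.grClass_eq_of_sub_mem _ _ ?_
  rw [List.map_cons, ncEsymm_cons_succ, map_add, map_mul, add_sub_cancel_right]
  refine AlgFiltration.piece_le_lower ?_
    (mem_algFiltration_of_mem (ncEsymm_mem_filtration hq (k + 1)))
  rw [← hdeg, G.level_tail]
  exact topSum_lt _ _

/-- The defining relations of `A(Γ)`, up to sign. -/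
theorem coeffClass_congr (hmin : ∃! v : V, G.level v = 0) {v w₁ w₂ : V} {q₁ q₂ : List E}
    (h₁ : G.IsPath v q₁ w₁) (h₂ : G.IsPath v q₂ w₂) (hw₁ : G.level w₁ = 0) (hw₂ : G.level w₂ = 0)
    (k : ℕ) : coeffClass F h₁ k = coeffClass F h₂ k := by
  obtain rfl := hmin.unique hw₁ hw₂
  have hl₁ := h₁.level_eq
  have hl₂ := h₂.level_eq
  refine AlgFiltration.grClass_congr rfl ?_ _
  rcases Nat.eq_zero_or_pos k with rfl | hk
  · simp
  rcases lt_or_ge q₁.length k with hkl | hkl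
  · rw [ncEsymm_of_length_lt _ (by simpa using hkl),
      ncEsymm_of_length_lt _ (by simp only [List.length_map]; omega)]
  have h : G.toAlg F (pathCoeff F q₁ k) = G.toAlg F (pathCoeff F q₂ k) :=
    TwoSidedIdeal.mkₐ_eq_of_sub_mem ⟨v, w₁, q₁, q₂, k, h₁, h₂, hk, hkl, rfl⟩
  rw [pathCoeff_eq, pathCoeff_eq, map_mul, map_mul, map_pow, map_neg, map_one] at h
  exact (isUnit_one.neg.pow k).mul_left_cancel h

theorem exists_isPath_bottom (hout : ∀ v : V, 0 < G.level v → ∃ e : E, G.tail e = v) (v : V) :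
    ∃ q w, G.IsPath v q w ∧ G.level w = 0 := by
  obtain ⟨q, w, h, hl⟩ := exists_isPath_length_eq hout v
  have := h.level_eq
  exact ⟨q, w, h, by omega⟩

/-- The class of an edge depends only on its tail. -/
theorem edgeClass_eq_of_tail_eq (hmin : ∃! v : V, G.level v = 0)
    (hout : ∀ v : V, 0 < G.level v → ∃ e : E, G.tail e = v) {e e' : E} (h : G.tail e = G.tail e') :
    G.edgeClass F e = G.edgeClass F e' := by
  have key : ∀ e : E, ∀ v q w, ∀ hq : G.IsPath v q w, G.level w = 0 → G.tail e = v →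
      G.edgeClass F e = coeffClass F hq 1 := by
    rintro e _ q w hq hw rfl
    obtain ⟨q', w', hq', hw'⟩ := exists_isPath_bottom hout (G.head e)
    have h1 := coeffClass_cons (F := F) hq' 0
    rw [coeffClass_zero, mul_one] at h1
    rw [← h1]
    exact coeffClass_congr hmin _ hq hw' hw _
  obtain ⟨q, w, hq, hw⟩ := exists_isPath_bottom hout (G.tail e)
  rw [key e _ q w hq hw rfl, key e' _ q w hq hw h.symm]

/-- The product of the classes of edges from the first `k` vertices of a path that starts at `v`
is the class of `(-1) ^ k e(q, k)`, for any path `q` from `v` to the minimal vertex. -/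
theorem lift_edgeClass_vertexWord (hmin : ∃! v : V, G.level v = 0)
    (hout : ∀ v : V, 0 < G.level v → ∃ e : E, G.tail e = v) {o : G.VPlus → E}
    (ho : ∀ v, G.tail (o v) = v.1) {v w u : V} {p q : List E} (hp : G.IsPath v p w)
    (hq : G.IsPath v q u) (hu : G.level u = 0) {k : ℕ} (hk : k ≤ G.level v)
    (hkp : k ≤ p.length + 1) :
    TensorOn.lift F (fun v => G.edgeClass F (o v)) (G.vertexWord F v p k) = coeffClass F hq k := by
  have hgen : ∀ e, TensorOn.lift F (fun v => G.edgeClass F (o v)) (G.vertexGen F (G.tail e)) =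
      G.edgeClass F e := by
    intro e
    rw [vertexGen_of_pos F (by rw [G.level_tail]; omega), TensorOn.lift_gen]
    exact edgeClass_eq_of_tail_eq hmin hout (ho _)
  induction p generalizing v q u k with
  | nil =>
    cases k with
    | zero => rw [vertexWord_zero, map_one, coeffClass_zero]
    | succ k =>
      obtain rfl : k = 0 := by simpa using hkp
      obtain ⟨e, rfl⟩ := hout v hk
      obtain ⟨q', w', hq', hw'⟩ := exists_isPath_bottom hout (G.head e)
      rw [vertexWord_nil_succ, hgen, coeffClass_congr hmin hq
        (show G.IsPath (G.tail e) (e :: q') w' from ⟨rfl, hq'⟩) hu hw', coeffClass_cons hq',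
        coeffClass_zero, mul_one]
  | cons e p ih =>
    obtain ⟨rfl, hp⟩ := hp
    cases k with
    | zero => rw [vertexWord_zero, map_one, coeffClass_zero]
    | succ k =>
      obtain ⟨q', w', hq', hw'⟩ := exists_isPath_bottom hout (G.head e)
      rw [G.level_tail] at hk
      rw [vertexWord_cons_succ, map_mul, hgen,
        ih hp hq' hw' (by omega) (by simpa using hkp), coeffClass_congr hmin hq
        (show G.IsPath (G.tail e) (e :: q') w' from ⟨rfl, hq'⟩) hu hw', coeffClass_cons]

/-- The algebra map `T(V⁺) / R_gr → gr A(Γ)` that sends each vertex to the class of the edges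
that start there. -/
theorem exists_toGrAlg (hmin : ∃! v : V, G.level v = 0)
    (hout : ∀ v : V, 0 < G.level v → ∃ e : E, G.tail e = v) {o : G.VPlus → E}
    (ho : ∀ v, G.tail (o v) = v.1) : ∃ Θ : G.GrQuotient F →ₐ[F] G.GrAlg F,
      ∀ a, Θ (G.toGrQuotient F a) = TensorOn.lift F (fun v => G.edgeClass F (o v)) a := by
  refine TwoSidedIdeal.exists_lift_span (G.grRelators F)
    (TensorOn.lift F fun v => G.edgeClass F (o v)) ?_
  rintro _ ⟨v, w₁, w₂, p₁, p₂, k, h₁, h₂, _, hk₁, hk₂, rfl⟩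
  obtain ⟨q, u, hq, hu⟩ := exists_isPath_bottom hout v
  have hl := h₁.level_eq
  -- `gr A(Γ)` only carries a semiring structure here, so `map_sub` is not available
  rw [sub_eq_add_neg, map_add,
    lift_edgeClass_vertexWord hmin hout ho h₁ hq hu (by omega) (by omega),
    ← lift_edgeClass_vertexWord hmin hout ho h₂ hq hu (by omega) hk₂, ← map_add, add_neg_cancel,
    map_zero]

/-! ### Bijectivity -/

/-- Products of edges act on the filtration of `T(V⁺) / R_gr` with the expected degree. -/
theorem action_mem_of_mem (S : SymbolAlgebra G F (G.GrQuotient F))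
    {ρ : G.Alg F →ₐ[F] Module.End F (G.GrQuotient F)}
    (hρ : ∀ (e : E) (j : ℤ), ∀ y ∈ S.fil j, ρ (G.toAlg F (TensorOn.gen F e)) y -
      S.x (G.tail e) * y ∈ S.fil (j + G.edgeDegree e - 1))
    {i : ℕ} {a : G.Alg F} (ha : a ∈ (G.algFiltration F).piece i) {j : ℤ} {y : G.GrQuotient F}
    (hy : y ∈ S.fil j) : ρ a y ∈ S.fil (j + i) := by
  obtain ⟨t, ht, rfl⟩ := ha
  change t ∈ Submodule.span F _ at ht
  have hword : ∀ l : List E, ρ (G.toAlg F (TensorOn.word F l)) y ∈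
      S.fil (j + ((l.map G.edgeDegree).sum : ℕ)) := by
    intro l
    induction l with
    | nil => simpa using hy
    | cons e l ih =>
      rw [TensorOn.word_cons, map_mul, map_mul, Module.End.mul_apply, ← sub_add_cancel
        (ρ (G.toAlg F (TensorOn.gen F e)) (ρ (G.toAlg F (TensorOn.word F l)) y))
        (S.x (G.tail e) * ρ (G.toAlg F (TensorOn.word F l)) y), List.map_cons, List.sum_cons]
      refine add_mem (S.fil_mono ?_ (hρ e _ _ ih)) (S.fil_mono ?_ (S.x_mul_mem ih))
      · push_cast; linarith
      · rw [edgeDegree]; push_cast; linarith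
  induction ht using Submodule.span_induction with
  | mem t ht =>
    obtain ⟨l, hl, rfl⟩ := ht
    exact S.fil_mono (by gcongr) (hword l)
  | zero => rw [map_zero, map_zero]; exact zero_mem _
  | add a b _ _ ha hb => rw [map_add, map_add]; exact add_mem ha hb
  | smul c a _ ha => rw [map_smul, map_smul]; exact Submodule.smul_mem _ c ha

theorem toGrQuotient_word_mem_grFil (l : List G.VPlus) :
    G.toGrQuotient F (TensorOn.word F l) ∈ G.grFil F ((l.map G.vertexDegree).sum : ℕ) :=
  mem_grFil.2 fun i hi => by rw [grPart_word, if_neg hi.ne]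

theorem grPart_mem_grQuotientComponent (i : ℕ) (b : G.GrQuotient F) :
    G.grPart F i b ∈ G.grQuotientComponent F i := by
  obtain ⟨a, rfl⟩ := toGrQuotient_surjective F b
  have ha : a ∈ Submodule.span F (Set.range (TensorOn.word F)) := by
    rw [TensorOn.span_word]; exact Submodule.mem_top
  induction ha using Submodule.span_induction with
  | mem a ha =>
    obtain ⟨l, rfl⟩ := ha
    rw [grPart_word]
    split_ifs with h
    · exact ⟨_, Submodule.subset_span ⟨l, by exact_mod_cast h, rfl⟩, rfl⟩
    · exact zero_mem _
  | zero => rw [map_zero, map_zero]; exact zero_mem _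
  | add a b _ _ ha hb => rw [map_add, map_add]; exact add_mem ha hb
  | smul c a _ ha => rw [map_smul, map_smul]; exact Submodule.smul_mem _ c ha

section bijective

variable {o : G.VPlus → E}

theorem map_edgeDegree_out (ho : ∀ v, G.tail (o v) = v.1) (l : List G.VPlus) :
    (l.map o).map G.edgeDegree = l.map G.vertexDegree := by
  rw [List.map_map]
  refine List.map_congr_left fun v _ => ?_
  rw [Function.comp_apply, edgeDegree, ho, vertexDegree]

/-- Homogeneous elements of `T(V⁺)` lift to elements of the same degree of `T(E)`. -/
theorem lift_edgeClass_of_mem_component (ho : ∀ v, G.tail (o v) = v.1) {i : ℕ}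
    {y : TensorOn F G.VPlus} (hy : y ∈ TensorOn.component F G.vertexDegree i) :
    ∃ h : G.toAlg F (TensorOn.lift F (fun v => TensorOn.gen F (o v)) y) ∈
      (G.algFiltration F).piece i, TensorOn.lift F (fun v => G.edgeClass F (o v)) y =
        (G.algFiltration F).grClass _ h := by
  change y ∈ Submodule.span F _ at hy
  induction hy using Submodule.span_induction with
  | mem y hy =>
    obtain ⟨l, rfl, rfl⟩ := hy
    have h1 : TensorOn.lift F (fun v => TensorOn.gen F (o v)) (TensorOn.word F l) =
        TensorOn.word F (l.map o) := by
      rw [TensorOn.lift_word, TensorOn.word, List.map_map]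
      rfl
    have h2 := prod_edgeClass (F := F) (G := G) (l.map o)
    rw [List.map_map] at h2
    exact ⟨by
      rw [h1, ← map_edgeDegree_out ho]
      exact mem_algFiltration_of_mem (word_mem_filtration _),
      (TensorOn.lift_word _ _).trans <| h2.trans
        (AlgFiltration.grClass_congr (by rw [map_edgeDegree_out ho]) (by rw [h1]) _)⟩
  | zero =>
    simp only [map_zero]
    exact ⟨zero_mem _, (AlgFiltration.grClass_zero i).symm⟩
  | add a b _ _ ha hb =>
    obtain ⟨ha, ha'⟩ := ha
    obtain ⟨hb, hb'⟩ := hb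
    simp only [map_add, ha', hb']
    exact ⟨add_mem ha hb, (AlgFiltration.grClass_add ha hb).symm⟩
  | smul c a _ ha =>
    obtain ⟨ha, ha'⟩ := ha
    simp only [map_smul, ha']
    exact ⟨Submodule.smul_mem _ c ha, (AlgFiltration.grClass_smul c ha).symm⟩

/-- Lifting a homogeneous element of degree `i` to `T(E)` and letting it act on `1` gives back its
class up to terms of lower degree. -/
theorem action_lift_sub_mem (ho : ∀ v, G.tail (o v) = v.1)
    (S : SymbolAlgebra G F (G.GrQuotient F)) (hfil : S.fil = G.grFil F)
    (hx : S.x = G.vertexClass F) {ρ : G.Alg F →ₐ[F] Module.End F (G.GrQuotient F)}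
    (hρ : ∀ (e : E) (j : ℤ), ∀ y ∈ S.fil j, ρ (G.toAlg F (TensorOn.gen F e)) y -
      S.x (G.tail e) * y ∈ S.fil (j + G.edgeDegree e - 1)) {i : ℕ}
    {y : TensorOn F G.VPlus} (hy : y ∈ TensorOn.component F G.vertexDegree i) :
    ρ (G.toAlg F (TensorOn.lift F (fun v => TensorOn.gen F (o v)) y)) 1 - G.toGrQuotient F y ∈
      G.grFil F (i - 1) := by
  change y ∈ Submodule.span F _ at hy
  induction hy using Submodule.span_induction with
  | mem y hy =>
    obtain ⟨l, rfl, rfl⟩ := hy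
    induction l with
    | nil => simp
    | cons v l ih =>
      set z := ρ (G.toAlg F (TensorOn.lift F (fun v => TensorOn.gen F (o v))
        (TensorOn.word F l))) 1 with hz
      set m : ℕ := (l.map G.vertexDegree).sum with hm
      have hzm : z ∈ G.grFil F m := by
        rw [← sub_add_cancel z (G.toGrQuotient F (TensorOn.word F l))]
        exact add_mem (grFil_mono (by linarith) ih) (toGrQuotient_word_mem_grFil l)
      have h1 := hρ (o v) m z (hfil ▸ hzm)
      have h2 := S.x_mul_mem (v := v.1) (hfil.symm ▸ ih)
      have hxv : S.x v.1 = G.toGrQuotient F (TensorOn.gen F v) := by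
        rw [hx, vertexClass, vertexGen_of_pos F v.2]
      rw [hfil, ho, hxv, edgeDegree, ho] at h1
      rw [hfil, hxv, mul_sub] at h2
      rw [TensorOn.word_cons, map_mul, map_mul, map_mul, map_mul, Module.End.mul_apply, ← hz,
        TensorOn.lift_gen, List.map_cons, List.sum_cons, ← hm, vertexDegree]
      have h3 := add_mem
        (grFil_mono (b := ((G.level v.1 + m : ℕ) : ℤ) - 1) (by push_cast; linarith) h1)
        (grFil_mono (b := ((G.level v.1 + m : ℕ) : ℤ) - 1) (by push_cast; linarith) h2)
      rwa [sub_add_sub_cancel] at h3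
  | zero => simp
  | add a b _ _ ha hb =>
    simp only [map_add, LinearMap.add_apply]
    rw [add_sub_add_comm]
    exact add_mem ha hb
  | smul c a _ ha =>
    simp only [map_smul, LinearMap.smul_apply]
    rw [← smul_sub]
    exact Submodule.smul_mem _ c ha

variable {Θ : G.GrQuotient F →ₐ[F] G.GrAlg F}

theorem map_grQuotientComponent (hmin : ∃! v : V, G.level v = 0)
    (hout : ∀ v : V, 0 < G.level v → ∃ e : E, G.tail e = v) (ho : ∀ v, G.tail (o v) = v.1)
    (hΘ : ∀ a, Θ (G.toGrQuotient F a) = TensorOn.lift F (fun v => G.edgeClass F (o v)) a) (i : ℕ) :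
    (G.grQuotientComponent F i).map Θ.toLinearMap = (G.algFiltration F).grComponent i := by
  apply le_antisymm
  · rintro _ ⟨_, ⟨y, hy, rfl⟩, rfl⟩
    obtain ⟨h, h'⟩ := lift_edgeClass_of_mem_component ho hy
    exact AlgFiltration.mem_grComponent.2 ⟨_, h, (h'.symm.trans (hΘ y).symm)⟩
  · intro z hz
    obtain ⟨_, ⟨t, ht, rfl⟩, rfl⟩ := AlgFiltration.mem_grComponent.1 hz
    suffices h : ∃ hx, (G.algFiltration F).grClass (i := i) (G.toAlg F t) hx ∈
        (G.grQuotientComponent F i).map Θ.toLinearMap from h.2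
    clear hz
    change t ∈ Submodule.span F _ at ht
    induction ht using Submodule.span_induction with
    | mem t ht =>
      obtain ⟨l, hl, rfl⟩ := ht
      refine ⟨mem_algFiltration_of_mem (Submodule.subset_span ⟨l, hl, rfl⟩), ?_⟩
      rcases Nat.lt_or_eq_of_le hl with hl | rfl
      · rw [(AlgFiltration.grClass_eq_zero_iff _).2]
        · exact zero_mem _
        · exact AlgFiltration.piece_le_lower hl (mem_algFiltration_of_mem (word_mem_filtration l))
      · let l' : List G.VPlus := l.map fun e => ⟨G.tail e, by rw [G.level_tail]; omega⟩
        refine ⟨G.toGrQuotient F (TensorOn.word F l'), ⟨_, Submodule.subset_span ⟨l', ?_, rfl⟩,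
          rfl⟩, ?_⟩
        · rw [List.map_map]
          rfl
        · change Θ _ = _
          rw [hΘ, TensorOn.lift_word, List.map_map, ← prod_edgeClass]
          congr 1
          exact List.map_congr_left fun e _ => edgeClass_eq_of_tail_eq hmin hout (ho _)
    | zero =>
      refine ⟨by rw [map_zero]; exact zero_mem _, ?_⟩
      rw [AlgFiltration.grClass_congr rfl (map_zero _), AlgFiltration.grClass_zero]
      exact zero_mem _
    | add a b _ _ ha hb =>
      obtain ⟨ha, ha'⟩ := ha
      obtain ⟨hb, hb'⟩ := hb
      refine ⟨by rw [map_add]; exact add_mem ha hb, ?_⟩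
      rw [AlgFiltration.grClass_congr rfl (map_add _ _ _), AlgFiltration.grClass_add ha hb]
      exact add_mem ha' hb'
    | smul c a _ ha =>
      obtain ⟨ha, ha'⟩ := ha
      refine ⟨by rw [map_smul]; exact Submodule.smul_mem _ c ha, ?_⟩
      rw [AlgFiltration.grClass_congr rfl (map_smul _ _ _), AlgFiltration.grClass_smul c ha]
      exact Submodule.smul_mem _ c ha'

theorem toGrAlg_surjective
    (hcomp : ∀ i, (G.grQuotientComponent F i).map Θ.toLinearMap =
      (G.algFiltration F).grComponent i) : Function.Surjective Θ := by
  intro z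
  induction z using DirectSum.induction_on with
  | zero => exact ⟨0, map_zero _⟩
  | of i x =>
    have hx : DirectSum.of (G.algFiltration F).Gr i x ∈ (G.algFiltration F).grComponent i :=
      ⟨x, rfl⟩
    rw [← hcomp i] at hx
    obtain ⟨b, _, hb⟩ := hx
    exact ⟨b, hb⟩
  | add x y hx hy =>
    obtain ⟨a, rfl⟩ := hx
    obtain ⟨b, rfl⟩ := hy
    exact ⟨a + b, map_add _ _ _⟩

/-- The map `Θ` is graded, hence commutes with taking components. -/
theorem toGrAlg_grPart
    (hcomp : ∀ i, (G.grQuotientComponent F i).map Θ.toLinearMap =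
      (G.algFiltration F).grComponent i) (i : ℕ) (b : G.GrQuotient F) :
    Θ (G.grPart F i b) = DirectSum.lof F ℕ (G.algFiltration F).Gr i (Θ b i) := by
  have h : Θ.toLinearMap.comp (G.grPart F i) = (DirectSum.lof F ℕ (G.algFiltration F).Gr i).comp
      ((DirectSum.component F ℕ (G.algFiltration F).Gr i).comp Θ.toLinearMap) := by
    refine grQuotient_ext F fun l => ?_
    obtain ⟨x, hx⟩ : Θ (G.toGrQuotient F (TensorOn.word F l)) ∈
        (G.algFiltration F).grComponent (l.map G.vertexDegree).sum := by
      rw [← hcomp]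
      exact ⟨_, ⟨_, Submodule.subset_span ⟨l, rfl, rfl⟩, rfl⟩, rfl⟩
    change Θ (G.grPart F i _) = DirectSum.lof F ℕ (G.algFiltration F).Gr i
      (DirectSum.component F ℕ (G.algFiltration F).Gr i (Θ _))
    rw [grPart_word, ← hx]
    split_ifs with h
    · obtain rfl : (l.map G.vertexDegree).sum = i := by exact_mod_cast h
      rw [DirectSum.component.lof_self, hx]
    · have h' : (l.map G.vertexDegree).sum ≠ i := by exact_mod_cast h
      rw [DirectSum.component.of, dif_neg h', map_zero, map_zero]
  exact LinearMap.congr_fun h b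

theorem toGrAlg_injective (hout : ∀ v : V, 0 < G.level v → ∃ e : E, G.tail e = v)
    (ho : ∀ v, G.tail (o v) = v.1)
    (hΘ : ∀ a, Θ (G.toGrQuotient F a) = TensorOn.lift F (fun v => G.edgeClass F (o v)) a)
    (hcomp : ∀ i, (G.grQuotientComponent F i).map Θ.toLinearMap =
      (G.algFiltration F).grComponent i) : Function.Injective Θ := by
  rw [injective_iff_map_eq_zero]
  intro b hb
  choose p w hp using fun v => exists_isPath_length_eq hout v
  set S := symbolAlgebra (F := F) (p := p) fun v => ⟨w v, hp v⟩ with hS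
  obtain ⟨ρ, hρ⟩ := S.exists_action hout
  rw [← sum_grPart F b]
  refine Finset.sum_eq_zero fun i _ => ?_
  rcases lt_or_ge i 0 with hi | hi
  · rw [grPart_of_neg F hi, LinearMap.zero_apply]
  lift i to ℕ using hi
  have h0 : Θ (G.grPart F i b) = 0 := by
    rw [toGrAlg_grPart hcomp, hb]
    exact map_zero _
  obtain ⟨y, hy, hyb⟩ := grPart_mem_grQuotientComponent i b
  change G.toGrQuotient F y = _ at hyb
  obtain ⟨hmem, hcls⟩ := lift_edgeClass_of_mem_component ho hy
  rw [← hyb, hΘ, hcls, AlgFiltration.grClass_eq_zero_iff] at h0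
  -- the lift of `y` to `A(Γ)` lies in a lower step, and so does its value at `1`
  have h1 : ρ (G.toAlg F (TensorOn.lift F (fun v => TensorOn.gen F (o v)) y)) 1 ∈
      G.grFil F (i - 1) := by
    cases i with
    | zero =>
      rw [show G.toAlg F (TensorOn.lift F (fun v => TensorOn.gen F (o v)) y) = 0 from h0, map_zero]
      exact zero_mem _
    | succ i =>
      have hone : (1 : G.GrQuotient F) ∈ G.grFil F 0 := by
        simpa using toGrQuotient_word_mem_grFil (F := F) (G := G) []
      have := action_mem_of_mem S hρ h0 (j := 0) hone
      exact grFil_mono (by push_cast; linarith) this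
  have h2 := sub_mem h1 (action_lift_sub_mem ho S rfl rfl hρ hy)
  rw [sub_sub_cancel, hyb] at h2
  have h3 := mem_grFil.1 h2 i (by linarith)
  rwa [grPart_grPart, if_pos rfl] at h3

end bijective

end LayeredGraph

theorem proposition2p5 {F : Type*} [Field F] {V : Type*} {E : Type*} (G : LayeredGraph V E)
    (hmin : ∃! v : V, G.level v = 0)
    (hout : ∀ v : V, 0 < G.level v → ∃ e : E, G.tail e = v) :
    ∃ φ : G.GrAlg F ≃ₐ[F] G.GrQuotient F,
      (∀ i : ℕ, ((G.algFiltration F).grComponent i).map φ.toLinearMap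
        = G.grQuotientComponent F i) ∧
      ∀ e : E, φ (G.edgeClass F e) = G.toGrQuotient F (G.vertexGen F (G.tail e)) := by
  choose o ho using fun v : G.VPlus => hout v.1 v.2
  obtain ⟨Θ, hΘ⟩ := LayeredGraph.exists_toGrAlg (F := F) hmin hout ho
  have hcomp := LayeredGraph.map_grQuotientComponent hmin hout ho hΘ
  let ψ : G.GrQuotient F ≃ₐ[F] G.GrAlg F := AlgEquiv.ofBijective Θ
    ⟨LayeredGraph.toGrAlg_injective hout ho hΘ hcomp, LayeredGraph.toGrAlg_surjective hcomp⟩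
  refine ⟨ψ.symm, fun i => ?_, fun e => ?_⟩
  · rw [← hcomp i]
    ext b
    constructor
    · rintro ⟨_, ⟨c, hc, rfl⟩, rfl⟩
      have : ψ.symm (ψ c) = c := ψ.symm_apply_apply c
      exact this.symm ▸ hc
    · exact fun hb => ⟨Θ b, ⟨b, hb, rfl⟩, ψ.symm_apply_apply b⟩
  · rw [AlgEquiv.symm_apply_eq]
    change _ = Θ _
    rw [hΘ, LayeredGraph.vertexGen_of_pos F (by rw [G.level_tail]; omega), TensorOn.lift_gen]
    exact LayeredGraph.edgeClass_eq_of_tail_eq hmin hout (ho ⟨G.tail e, _⟩).symm
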